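/- Let $G=(V,E)$ be a finite graph with $n=|V|$ vertices, let $J_{uv}\ge 0$ for $uv\in E$, and suppose that the graph $(V,\{uv\in E: J_{uv}>0\})$ is connected. Fix an edge $u_0v_0\in E$, and for $t\ge 0$ and $x\in\mathbb{C}$ put $$Z_t(x)=\sum_{\sigma\in\{-1,+1\}^V}\exp\Big[t\,\sigma_{u_0}\sigma_{v_0}+\sum_{uv\in E}J_{uv}\sigma_u\sigma_v+ix\sum_{u\in V}\sigma_u\Big].$$ Let $x_1(t)\le x_2(t)\le\dots$ be the positive real zeros of $Z_t$, listed according to their multiplicities. Then, for each $t\ge 0$, the zeros of $Z_t$ in $\mathbb{C}$ are exactly the points $\pm x_k(t)+m\pi$ with $m\in\mathbb{Z}$ and $1\le k\le\lfloor (n+1)/2\rfloor$, and the following holds. If $n$ is even, then $0<x_1(t)<x_2(t)<\dots<x_{n/2}(t)<\pi/2$ for all $t\in[0,\infty)$. If $n$ is odd, then $0<x_1(t)<\dots<x_{(n-1)/2}(t)<\pi/2=x_{(n+1)/2}(t)$ for all $t\in[0,\infty)$. Moreover, for each $k\in\{1,\dots,\lfloor n/2\rfloor\}$, exactly one of the following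 three cases occurs: a) $x_k(t)=x_k(0)$ for each $t\in[0,\infty)$; b) $x_k$ is strictly decreasing on $[0,\infty)$ and $x_k(t)\in(x_{k-1}(0),x_k(0))$ for each $t\in(0,\infty)$; c) $x_k$ is strictly increasing on $[0,\infty)$ and $x_k(t)\in(x_k(0),x_{k+1}(0))$ for each $t\in(0,\infty)$; where in b) $x_0(0)$ is read as $0$ and, if $n$ is even, in c) $x_{n/2+1}(0)$ is read as $\pi/2$. Finally, the trajectories $x_j([0,\infty))$ and $x_k([0,\infty))$ are disjoint for all $j\ne k$ in $\{1,\dots,\lfloor (n+1)/2\rfloor\}$. -/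

import Mathlib

open scoped Real

noncomputable section

namespace LeeYang

/-- A spin configuration `σ ∈ {-1,+1}^V`. -/
abbrev Config (V : Type*) := V → ℤˣ

/-- The spin at `u` as a real number, `-1` or `+1`. -/
def spin {V : Type*} (σ : Config V) (u : V) : ℝ := ((σ u : ℤ) : ℝ)

/-- The product `σ_u σ_v` of the spins at the two ends of an unordered pair `uv`. -/
def edgeSpin {V : Type*} (σ : Config V) : Sym2 V → ℝ :=
  Sym2.lift ⟨fun u v => spin σ u * spin σ v, fun _ _ => mul_comm _ _⟩

/-- The partition function
`Z_t(x) = ∑_σ exp [t σ_{u₀} σ_{v₀} + ∑_{uv ∈ E} J_{uv} σ_u σ_v + i x ∑_u σ_u]`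
of the Ising model on `G` with couplings `J`, where `t` is added to the coupling on the
edge `e₀ = u₀v₀` and the external field is `i x` with `x ∈ ℂ`. -/
def partitionFn {V : Type*} [Fintype V] [DecidableEq V] (G : SimpleGraph V)
    [DecidableRel G.Adj] (J : Sym2 V → ℝ) (e₀ : Sym2 V) (t : ℝ) (x : ℂ) : ℂ :=
  ∑ σ : Config V, Complex.exp
    (((t * edgeSpin σ e₀ + ∑ e ∈ G.edgeFinset, J e * edgeSpin σ e : ℝ) : ℂ)
      + Complex.I * x * ((∑ u, spin σ u : ℝ) : ℂ))

/-- The graph `G_{>0}` on all vertices of `G` that keeps the edges with `J_{uv} > 0`. -/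
def posGraph {V : Type*} (G : SimpleGraph V) (J : Sym2 V → ℝ) : SimpleGraph V where
  Adj u v := G.Adj u v ∧ 0 < J s(u, v)
  symm := ⟨fun u v h => ⟨h.1.symm, by rw [Sym2.eq_swap]; exact h.2⟩⟩
  loopless := ⟨fun u h => G.loopless.irrefl u h.1⟩

/-- The number of real zeros of `f` in `(0, r]`, counted with multiplicity (the order of
vanishing of `f` as an analytic function on `ℂ`). -/
def zeroCount (f : ℂ → ℂ) (r : ℝ) : ℕ :=
  ∑ᶠ y ∈ Set.Ioc (0 : ℝ) r, analyticOrderNatAt f (y : ℂ)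

/-- The `k`-th positive zero of `f` (`k = 1, 2, …`), when the positive zeros are listed in
nondecreasing order according to their multiplicities: the least `r > 0` such that `(0, r]`
holds at least `k` zeros. -/
def posZero (f : ℂ → ℂ) (k : ℕ) : ℝ :=
  sInf {r : ℝ | 0 < r ∧ k ≤ zeroCount f r}

/-- `x_k(t)`, the `k`-th positive zero of the partition function `Z_t`. -/
def isingZero {V : Type*} [Fintype V] [DecidableEq V] (G : SimpleGraph V)
    [DecidableRel G.Adj] (J : Sym2 V → ℝ) (e₀ : Sym2 V) (k : ℕ) (t : ℝ) : ℝ :=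
  posZero (partitionFn G J e₀ t) k

/-- Exactly one of three propositions holds. -/
def ExactlyOne (a b c : Prop) : Prop :=
  (a ∧ ¬ b ∧ ¬ c) ∨ (¬ a ∧ b ∧ ¬ c) ∨ (¬ a ∧ ¬ b ∧ c)

/-- The trichotomy for a trajectory `x : [0, ∞) → ℝ` with left and right barriers `l`, `r`:
exactly one of the following occurs: `x` is constant; `x` is strictly decreasing and stays in
`(l, x 0)` for positive times; `x` is strictly increasing and stays in `(x 0, r)` for positive
times. -/
def Trichotomy (x : ℝ → ℝ) (l r : ℝ) : Prop :=
  ExactlyOne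
    (∀ t, 0 ≤ t → x t = x 0)
    (StrictAntiOn x (Set.Ici 0) ∧ ∀ t, 0 < t → x t ∈ Set.Ioo l (x 0))
    (StrictMonoOn x (Set.Ici 0) ∧ ∀ t, 0 < t → x t ∈ Set.Ioo (x 0) r)

end LeeYang

end

/-!
The substitution `z = exp (2 i x)` turns `Z_t(x)` into `exp (-i n x) P(z)`, where `P` is the
diagonal restriction of a polynomial `∑_σ f(σ) ∏_{σ_u = +1} z_u` that is affine in each fugacity.

**Lee–Yang.** Adding a ferromagnetic bond to this multi-affine polynomial amounts to two Asano
contractions with the polynomial of a single edge, so it never vanishes in the open unit polydisc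
(`isLeeYang_isingWeight`). Writing it as `R + z_v Q` for a vertex `v`, one gets `|Q| ≤ |R|` in the
closed polydisc (`IsLeeYang.norm_plusPart_le`). If the positive couplings connect the graph, then
`R` does not vanish even on the closed polydisc: a zero with `z_v = 0` remains a zero when the
fugacity of a neighbour is set to `0` too, and by connectedness all fugacities could be set to `0`,
where the polynomial is positive (`fugacitySum_ne_zero_of_connected`). On the diagonal this gives
`|P(r z)| ≥ (1 - r) |R(r z)|` for `|z| = 1`, so the zeros of `P` on the circle are simple
(`derivative_fugacityPoly_ne_zero`).

**Counting.** The spin-flip symmetry puts all zeros of `P` on the circle. Hence `Z_t` has exactly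
`n` zeros in `(0, π)`, all simple and symmetric about `π / 2`, which gives `⌊n/2⌋` zeros in
`(0, π/2)` and a zero at `π / 2` exactly for odd `n` (`exists_finset_zeros_lt_half_pi`).

**Trajectories.** Since zeros are simple and their number does not depend on `t`, each `x_k` is
continuous (`continuousOn_isingZero`). For fixed `x`, `Z_t(x)` is a combination of `e^t` and
`e^{-t}`, so if it vanishes for two values of `t` it vanishes for all, and then `x` is the constant
position of a single trajectory (`isingZero_eq_of_revisit`). Thus a trajectory is constant or
injective, hence constant or strictly monotone, and two trajectories never meet a common point,
even at different times; the barriers follow from the intermediate value theorem.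
-/

open scoped Real

noncomputable section

namespace LeeYang

/-! ### Asano contraction -/

/-- Asano's contraction: identifying the two variables of a bi-affine polynomial without zeros in
the open bidisc and keeping only the extreme coefficients preserves the absence of zeros. -/
theorem asano_contraction {α β γ δ : ℂ}
    (h : ∀ x y : ℂ, ‖x‖ < 1 → ‖y‖ < 1 → α + β * x + γ * y + δ * (x * y) ≠ 0)
    {z : ℂ} (hz : ‖z‖ < 1) : α + δ * z ≠ 0 := by
  intro h0
  have hα : α ≠ 0 := by simpa using h 0 0 (by simp) (by simp)
  have hδ : δ ≠ 0 := by
    rintro rfl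
    exact hα (by simpa using h0)
  -- the two roots of `α + (β + γ) x + δ x ^ 2` have product `α / δ = -z`
  obtain ⟨s, hs⟩ := IsAlgClosed.exists_pow_nat_eq ((β + γ) ^ 2 - 4 * δ * α) (n := 2) (by norm_num)
  have key : ∀ r : ℂ, α + (β + γ) * r + δ * r ^ 2 = 0 → 1 ≤ ‖r‖ := by
    intro r hr
    by_contra hlt
    push Not at hlt
    exact h r r hlt hlt (by linear_combination hr)
  have h1 := key ((-(β + γ) + s) / (2 * δ)) (by field_simp; linear_combination hs)
  have h2 := key ((-(β + γ) - s) / (2 * δ)) (by field_simp; linear_combination hs)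
  have h3 : (-(β + γ) + s) / (2 * δ) * ((-(β + γ) - s) / (2 * δ)) = -z := by
    field_simp
    linear_combination -hs + 4 * δ * h0
  have h4 := congrArg norm h3
  rw [norm_mul, norm_neg] at h4
  nlinarith

theorem edge_polynomial_ne_zero {a : ℝ} (ha0 : 0 ≤ a) (ha1 : a ≤ 1) {x y : ℂ}
    (hx : ‖x‖ < 1) (hy : ‖y‖ < 1) : 1 + a * x + a * y + x * y ≠ 0 := by
  intro h
  have h1 : x * (a + y) = -(1 + a * y) := by linear_combination h
  have h2 := congrArg Complex.normSq h1
  rw [map_mul, Complex.normSq_neg] at h2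
  have hx' : Complex.normSq x < 1 := by
    rw [Complex.normSq_eq_norm_sq]; nlinarith [norm_nonneg x]
  have hy' : Complex.normSq y < 1 := by
    rw [Complex.normSq_eq_norm_sq]; nlinarith [norm_nonneg y]
  have h3 : Complex.normSq (1 + a * y) - Complex.normSq (a + y)
      = (1 - a ^ 2) * (1 - Complex.normSq y) := by
    simp [Complex.normSq_apply]; ring
  have h4 : 0 ≤ (1 - a ^ 2) * (1 - Complex.normSq y) := by
    apply mul_nonneg <;> nlinarith
  have h5 : Complex.normSq (a + y) = 0 := by
    have := Complex.normSq_nonneg (a + y)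
    nlinarith
  have h6 : Complex.normSq (1 + a * y) = 0 := by rw [← h2, h5, mul_zero]
  rw [Complex.normSq_eq_zero] at h5 h6
  have h7 : y = -a := by linear_combination h5
  rw [h7, norm_neg, Complex.norm_real, Real.norm_of_nonneg ha0] at hy
  rw [h7] at h6
  have h8 : (1 : ℝ) - a * a = 0 := by
    have : ((1 - a * a : ℝ) : ℂ) = 0 := by push_cast; linear_combination h6
    exact_mod_cast this
  nlinarith

/-- A ferromagnetic bond damps the mixed coefficients of a bi-affine polynomial by a factor
`a ∈ [0, 1]`; this preserves the absence of zeros in the open bidisc, by two contractions with the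
polynomial of a single edge. -/
theorem damped_ne_zero {A B C D : ℂ}
    (h : ∀ x y : ℂ, ‖x‖ < 1 → ‖y‖ < 1 → A + B * x + C * y + D * (x * y) ≠ 0)
    {a : ℝ} (ha0 : 0 ≤ a) (ha1 : a ≤ 1) {x y : ℂ} (hx : ‖x‖ < 1) (hy : ‖y‖ < 1) :
    A + a * (B * x + C * y) + D * (x * y) ≠ 0 := by
  have h1 : ∀ w w' : ℂ, ‖w‖ < 1 → ‖w'‖ < 1 →
      (A + a * B * x) + (C + a * D * x) * w + (a * A + B * x) * w' + (a * C + D * x) * (w * w')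
        ≠ 0 := by
    intro w w' hw hw'
    have h2 := asano_contraction (α := (A + C * w) * (1 + a * w'))
      (β := (B + D * w) * (1 + a * w')) (γ := (A + C * w) * (a + w'))
      (δ := (B + D * w) * (a + w')) (fun x x' hx hx' => by
        have h3 := mul_ne_zero (h x w hx hw) (edge_polynomial_ne_zero ha0 ha1 hx' hw')
        intro h4
        exact h3 (by linear_combination h4)) hx
    intro h4
    exact h2 (by linear_combination h4)
  have h5 := asano_contraction h1 hy
  intro h6
  exact h5 (by linear_combination h6)

/-! ### Ising weights -/

theorem edgeSpin_mk {V : Type*} (σ : Config V) (u v : V) :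
    edgeSpin σ s(u, v) = if σ u = σ v then 1 else -1 := by
  simp only [edgeSpin, Sym2.lift_mk, spin]
  rcases Int.units_eq_one_or (σ u) with h | h <;> rcases Int.units_eq_one_or (σ v) with h' | h' <;>
    simp [h, h']

/-- The Boltzmann weight `exp (∑_{e ∈ F} J_e σ_u σ_v)` of a set `F` of bonds. -/
def isingWeight {V : Type*} (F : Finset (Sym2 V)) (J : Sym2 V → ℝ) (σ : Config V) : ℝ :=
  Real.exp (∑ e ∈ F, J e * edgeSpin σ e)

theorem isingWeight_insert {V : Type*} [DecidableEq V] {F : Finset (Sym2 V)} {J : Sym2 V → ℝ}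
    {e : Sym2 V} (he : e ∉ F) (σ : Config V) :
    isingWeight (insert e F) J σ = Real.exp (J e * edgeSpin σ e) * isingWeight F J σ := by
  rw [isingWeight, Finset.sum_insert he, Real.exp_add, isingWeight]

/-! ### The multi-affine partition function -/

variable {V : Type*} [Fintype V] [DecidableEq V]

/-- The generating function `∑_σ f(σ) ∏_{u : σ_u = +1} z_u` of a weight `f` on configurations,
with one fugacity `z_u` per vertex. -/
def fugacitySum (f : Config V → ℂ) (z : V → ℂ) : ℂ :=
  ∑ σ : Config V, f σ * ∏ u, if σ u = 1 then z u else 1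

/-- The part of a weight carried by the configurations with `σ_u = +1`. -/
def plusPart (f : Config V → ℂ) (u : V) : Config V → ℂ := fun σ => if σ u = 1 then f σ else 0

/-- The part of a weight carried by the configurations with `σ_u = -1`. -/
def minusPart (f : Config V → ℂ) (u : V) : Config V → ℂ := fun σ => if σ u = 1 then 0 else f σ

/-- A weight has the Lee–Yang property if its generating function has no zeros in the open unit
polydisc. -/
def IsLeeYang (f : Config V → ℂ) : Prop :=
  ∀ z : V → ℂ, (∀ u, ‖z u‖ < 1) → fugacitySum f z ≠ 0

theorem continuous_fugacitySum (f : Config V → ℂ) : Continuous (fugacitySum f) := by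
  unfold fugacitySum
  refine continuous_finsetSum _ fun σ _ => continuous_const.mul
    (continuous_finsetProd _ fun u _ => ?_)
  split_ifs
  · exact continuous_apply u
  · exact continuous_const

theorem fugacitySum_smul (c : ℂ) (f : Config V → ℂ) (z : V → ℂ) :
    fugacitySum (fun σ => c * f σ) z = c * fugacitySum f z := by
  simp only [fugacitySum, Finset.mul_sum, mul_assoc]

theorem prod_update_fugacity (σ : Config V) (z : V → ℂ) (u : V) (x : ℂ) :
    (∏ w, if σ w = 1 then Function.update z u x w else 1)
      = (if σ u = 1 then x else 1) * ∏ w, if σ w = 1 then Function.update z u 1 w else 1 := by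
  rw [← Finset.mul_prod_erase _ _ (Finset.mem_univ u),
    ← Finset.mul_prod_erase Finset.univ (fun w => if σ w = 1 then Function.update z u 1 w else 1)
      (Finset.mem_univ u)]
  simp only [Function.update_self, ite_self, one_mul]
  congr 1
  refine Finset.prod_congr rfl fun w hw => ?_
  rw [Function.update_of_ne (Finset.ne_of_mem_erase hw),
    Function.update_of_ne (Finset.ne_of_mem_erase hw)]

theorem fugacitySum_update (f : Config V → ℂ) (z : V → ℂ) (u : V) (x : ℂ) :
    fugacitySum f (Function.update z u x)
      = fugacitySum (minusPart f u) (Function.update z u 1)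
        + x * fugacitySum (plusPart f u) (Function.update z u 1) := by
  simp only [fugacitySum, Finset.mul_sum, ← Finset.sum_add_distrib]
  refine Finset.sum_congr rfl fun σ _ => ?_
  rw [prod_update_fugacity]
  by_cases h : σ u = 1 <;> simp [minusPart, plusPart, h]
  ring

theorem fugacitySum_eq_add (f : Config V → ℂ) (z : V → ℂ) (u : V) :
    fugacitySum f z
      = fugacitySum (minusPart f u) (Function.update z u 1)
        + z u * fugacitySum (plusPart f u) (Function.update z u 1) := by
  rw [← fugacitySum_update, Function.update_eq_self]

/-- In the closed polydisc the part with `σ_u = +1` is dominated by the part with `σ_u = -1`: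
otherwise the generating function, affine in `z_u`, would have a zero with `|z_u| < 1`. -/
theorem IsLeeYang.norm_plusPart_le {f : Config V → ℂ} (hf : IsLeeYang f) (u : V) {z : V → ℂ}
    (hz : ∀ w, ‖z w‖ ≤ 1) :
    ‖fugacitySum (plusPart f u) (Function.update z u 1)‖
      ≤ ‖fugacitySum (minusPart f u) (Function.update z u 1)‖ := by
  have hopen : ∀ z : V → ℂ, (∀ w, ‖z w‖ < 1) →
      ‖fugacitySum (plusPart f u) (Function.update z u 1)‖
        ≤ ‖fugacitySum (minusPart f u) (Function.update z u 1)‖ := by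
    intro z hz
    by_contra! hlt
    set Q := fugacitySum (plusPart f u) (Function.update z u 1)
    set R := fugacitySum (minusPart f u) (Function.update z u 1)
    have hQ : Q ≠ 0 := by
      intro h
      rw [h, norm_zero] at hlt
      exact absurd hlt (not_lt.2 (norm_nonneg _))
    refine hf (Function.update z u (-R / Q)) (fun w => ?_) ?_
    · by_cases hw : w = u
      · subst hw
        rw [Function.update_self, norm_div, norm_neg, div_lt_one (norm_pos_iff.2 hQ)]
        exact hlt
      · rw [Function.update_of_ne hw]
        exact hz w
    · rw [fugacitySum_update]
      change R + -R / Q * Q = 0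
      field_simp
      ring
  -- approximate `z` from the open polydisc by `r z`, `r → 1`
  have hcont : Continuous fun r : ℝ => Function.update (fun w => (r : ℂ) * z w) u (1 : ℂ) := by
    refine Continuous.update (continuous_pi fun w => ?_) u continuous_const
    exact Complex.continuous_ofReal.mul continuous_const
  have hlim : ∀ g : Config V → ℂ, Filter.Tendsto
      (fun r : ℝ => ‖fugacitySum g (Function.update (fun w => (r : ℂ) * z w) u (1 : ℂ))‖)
      (nhdsWithin 1 (Set.Iio 1)) (nhds ‖fugacitySum g (Function.update z u 1)‖) := by
    intro g
    have h1 := (((continuous_fugacitySum g).comp hcont).norm.tendsto 1).mono_left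
      (nhdsWithin_le_nhds (s := Set.Iio 1))
    simpa using h1
  refine le_of_tendsto_of_tendsto (hlim _) (hlim _) ?_
  have : Set.Ioo (0 : ℝ) 1 ∈ nhdsWithin (1 : ℝ) (Set.Iio 1) := Ioo_mem_nhdsLT one_pos
  filter_upwards [this] with r hr
  refine hopen _ fun w => ?_
  rw [norm_mul, Complex.norm_real, Real.norm_of_nonneg hr.1.le]
  nlinarith [hz w, norm_nonneg (z w), hr.1, hr.2]

/-! ### The Lee–Yang theorem for ferromagnetic Ising weights -/

theorem fugacitySum_update_update (f : Config V → ℂ) (z : V → ℂ) {u v : V} (huv : u ≠ v)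
    (x y : ℂ) :
    fugacitySum f (Function.update (Function.update z u x) v y)
      = fugacitySum (minusPart (minusPart f v) u) (Function.update (Function.update z u 1) v 1)
        + fugacitySum (plusPart (minusPart f v) u) (Function.update (Function.update z u 1) v 1) * x
        + fugacitySum (minusPart (plusPart f v) u) (Function.update (Function.update z u 1) v 1) * y
        + fugacitySum (plusPart (plusPart f v) u) (Function.update (Function.update z u 1) v 1)
          * (x * y) := by
  rw [fugacitySum_update f, Function.update_comm huv, fugacitySum_update (minusPart f v),
    fugacitySum_update (plusPart f v), Function.update_comm huv.symm]
  ring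

/-- The Lee–Yang theorem. -/
theorem isLeeYang_isingWeight (F : Finset (Sym2 V)) (J : Sym2 V → ℝ)
    (hF : ∀ e ∈ F, ¬ e.IsDiag) (hJ : ∀ e ∈ F, 0 ≤ J e) :
    IsLeeYang fun σ : Config V => (isingWeight F J σ : ℂ) := by
  induction F using Finset.induction_on with
  | empty =>
    intro z hz
    have : fugacitySum (fun σ : Config V => (isingWeight ∅ J σ : ℂ)) z = ∏ u, (1 + z u) := by
      have h1 : ∀ u, 1 + z u = ∑ s : ℤˣ, if s = 1 then z u else 1 := by
        intro u
        simp [add_comm]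
      rw [Finset.prod_congr rfl fun u _ => h1 u, Finset.prod_univ_sum, Fintype.piFinset_univ]
      simp only [fugacitySum, isingWeight, Finset.sum_empty, Real.exp_zero, Complex.ofReal_one,
        one_mul]
    rw [this, Finset.prod_ne_zero_iff]
    intro u _ h
    have h2 : z u = -1 := by linear_combination h
    have := hz u
    rw [h2] at this
    norm_num at this
  | insert e F he ih =>
    have ih := ih (fun e he => hF e (Finset.mem_insert_of_mem he))
      (fun e he => hJ e (Finset.mem_insert_of_mem he))
    have hdiag := hF e (Finset.mem_insert_self _ _)
    have hJe := hJ e (Finset.mem_insert_self _ _)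
    induction e using Sym2.ind with
    | _ u v =>
    have huv : u ≠ v := by simpa using hdiag
    intro z hz
    set f : Config V → ℂ := fun σ => (isingWeight F J σ : ℂ) with hf
    set j := J s(u, v) with hj
    have hz' : z = Function.update (Function.update z u (z u)) v (z v) := by simp
    have hE : ∀ σ : Config V, (isingWeight (insert s(u, v) F) J σ : ℂ)
        = (if σ u = σ v then (Real.exp j : ℂ) else (Real.exp (-j) : ℂ)) * f σ := by
      intro σ
      rw [isingWeight_insert he, edgeSpin_mk, ← hj, hf]
      split_ifs <;> simp
    have hneg : (-1 : ℤˣ) ≠ 1 := by decide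
    have hu := fun σ : Config V => Int.units_eq_one_or (σ u)
    have hv := fun σ : Config V => Int.units_eq_one_or (σ v)
    have hA : minusPart (minusPart (fun σ => (isingWeight (insert s(u, v) F) J σ : ℂ)) v) u
        = fun σ => (Real.exp j : ℂ) * minusPart (minusPart f v) u σ := by
      funext σ
      rcases hu σ with h | h <;> rcases hv σ with h' | h' <;> simp [minusPart, hE, h, h', hneg]
    have hB : plusPart (minusPart (fun σ => (isingWeight (insert s(u, v) F) J σ : ℂ)) v) u
        = fun σ => (Real.exp (-j) : ℂ) * plusPart (minusPart f v) u σ := by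
      funext σ
      rcases hu σ with h | h <;> rcases hv σ with h' | h' <;>
        simp [minusPart, plusPart, hE, h, h', hneg, hneg.symm]
    have hC : minusPart (plusPart (fun σ => (isingWeight (insert s(u, v) F) J σ : ℂ)) v) u
        = fun σ => (Real.exp (-j) : ℂ) * minusPart (plusPart f v) u σ := by
      funext σ
      rcases hu σ with h | h <;> rcases hv σ with h' | h' <;>
        simp [minusPart, plusPart, hE, h, h', hneg]
    have hD : plusPart (plusPart (fun σ => (isingWeight (insert s(u, v) F) J σ : ℂ)) v) u
        = fun σ => (Real.exp j : ℂ) * plusPart (plusPart f v) u σ := by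
      funext σ
      rcases hu σ with h | h <;> rcases hv σ with h' | h' <;> simp [plusPart, hE, h, h']
    rw [hz', fugacitySum_update_update _ _ huv, hA, hB, hC, hD]
    simp only [fugacitySum_smul]
    set A := fugacitySum (minusPart (minusPart f v) u)
      (Function.update (Function.update z u 1) v 1) with hAdef
    set B := fugacitySum (plusPart (minusPart f v) u)
      (Function.update (Function.update z u 1) v 1) with hBdef
    set C := fugacitySum (minusPart (plusPart f v) u)
      (Function.update (Function.update z u 1) v 1) with hCdef
    set D := fugacitySum (plusPart (plusPart f v) u)
      (Function.update (Function.update z u 1) v 1) with hDdef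
    have hbi : ∀ x y : ℂ, ‖x‖ < 1 → ‖y‖ < 1 → A + B * x + C * y + D * (x * y) ≠ 0 := by
      intro x y hx hy
      rw [hAdef, hBdef, hCdef, hDdef, ← fugacitySum_update_update f z huv]
      refine ih _ fun w => ?_
      by_cases hwv : w = v
      · subst hwv; simpa using hy
      · by_cases hwu : w = u
        · subst hwu; simpa [Function.update_of_ne hwv] using hx
        · simpa [Function.update_of_ne hwv, Function.update_of_ne hwu] using hz w
    have hd := damped_ne_zero hbi (Real.exp_pos (-2 * j)).le
      (by rw [Real.exp_le_one_iff]; linarith) (hz u) (hz v)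
    have hexp : (Real.exp (-j) : ℂ) = Real.exp j * Real.exp (-2 * j) := by
      rw [← Complex.ofReal_mul, ← Real.exp_add]; congr 2; ring
    have hne : (Real.exp j : ℂ) ≠ 0 := by exact_mod_cast (Real.exp_pos j).ne'
    intro h0
    apply mul_ne_zero hne hd
    rw [hexp] at h0
    linear_combination h0

/-! ### Nonvanishing on the closed polydisc for connected couplings -/

/-- A vanishing fugacity at `v` forces `σ_v = -1`, so that across a strictly ferromagnetic bond
`uv` the part with `σ_u = +1` is strictly dominated. Hence a zero of the generating function
persists when `z_u` is also set to `0`. -/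
theorem fugacitySum_update_zero_of_bond (F : Finset (Sym2 V)) (J : Sym2 V → ℝ)
    (hF : ∀ e ∈ F, ¬ e.IsDiag) (hJ : ∀ e ∈ F, 0 ≤ J e) {u v : V} (he : s(u, v) ∈ F)
    (hpos : 0 < J s(u, v)) {z : V → ℂ} (hz : ∀ w, ‖z w‖ ≤ 1) (hzv : z v = 0)
    (h0 : fugacitySum (fun σ => (isingWeight F J σ : ℂ)) z = 0) :
    fugacitySum (fun σ => (isingWeight F J σ : ℂ)) (Function.update z u 0) = 0 := by
  have huv : u ≠ v := by simpa using hF _ he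
  set j := J s(u, v) with hj
  set f : Config V → ℂ := fun σ => (isingWeight F J σ : ℂ) with hf
  set g : Config V → ℂ := fun σ => (isingWeight (F.erase s(u, v)) J σ : ℂ) with hg
  have hE : ∀ σ : Config V, f σ
      = (if σ u = σ v then (Real.exp j : ℂ) else (Real.exp (-j) : ℂ)) * g σ := by
    intro σ
    simp only [hf]
    rw [← Finset.insert_erase he, isingWeight_insert (Finset.notMem_erase _ _), edgeSpin_mk,
      ← hj, hg]
    split_ifs <;> simp
  have hgLY : IsLeeYang g := isLeeYang_isingWeight _ J
    (fun e he => hF e (Finset.mem_of_mem_erase he)) (fun e he => hJ e (Finset.mem_of_mem_erase he))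
  have hle := hgLY.norm_plusPart_le u hz
  have hprod : ∀ σ : Config V, σ v = 1 →
      (∏ w, if σ w = 1 then Function.update z u 1 w else 1) = 0 := by
    intro σ hσ
    refine Finset.prod_eq_zero (Finset.mem_univ v) ?_
    rw [if_pos hσ, Function.update_of_ne huv.symm, hzv]
  have hneg : (-1 : ℤˣ) ≠ 1 := by decide
  have hplus : fugacitySum (plusPart f u) (Function.update z u 1)
      = Real.exp (-j) * fugacitySum (plusPart g u) (Function.update z u 1) := by
    rw [← fugacitySum_smul]
    refine Finset.sum_congr rfl fun σ _ => ?_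
    rcases Int.units_eq_one_or (σ v) with h | h
    · rw [hprod σ h, mul_zero, mul_zero]
    · rcases Int.units_eq_one_or (σ u) with h' | h' <;>
        simp [plusPart, hE, h, h', hneg.symm]
  have hminus : fugacitySum (minusPart f u) (Function.update z u 1)
      = Real.exp j * fugacitySum (minusPart g u) (Function.update z u 1) := by
    rw [← fugacitySum_smul]
    refine Finset.sum_congr rfl fun σ _ => ?_
    rcases Int.units_eq_one_or (σ v) with h | h
    · rw [hprod σ h, mul_zero, mul_zero]
    · rcases Int.units_eq_one_or (σ u) with h' | h' <;>
        simp [minusPart, hE, h, h', hneg]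
  rw [fugacitySum_update, zero_mul, add_zero, hminus]
  rw [fugacitySum_eq_add f z u, hplus, hminus] at h0
  set Q := fugacitySum (plusPart g u) (Function.update z u 1)
  set R := fugacitySum (minusPart g u) (Function.update z u 1)
  have h1 : ‖(Real.exp j : ℂ) * R‖ = ‖z u * ((Real.exp (-j) : ℂ) * Q)‖ := by
    rw [← norm_neg]; congr 1; linear_combination -h0
  rw [norm_mul, norm_mul, norm_mul, Complex.norm_real, Complex.norm_real,
    Real.norm_of_nonneg (Real.exp_pos _).le, Real.norm_of_nonneg (Real.exp_pos _).le] at h1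
  have h2 : Real.exp (-j) < Real.exp j := Real.exp_lt_exp.2 (by linarith)
  have h3 : ‖R‖ = 0 := by
    by_contra hR
    have hR' : 0 < ‖R‖ := lt_of_le_of_ne (norm_nonneg _) (Ne.symm hR)
    have h4 : ‖z u‖ * (Real.exp (-j) * ‖Q‖) ≤ 1 * (Real.exp (-j) * ‖R‖) := by
      have := (Real.exp_pos (-j)).le
      gcongr
      exact hz u
    nlinarith
  rw [norm_eq_zero.1 h3, mul_zero]

theorem fugacitySum_ne_zero_of_connected (G : SimpleGraph V) [DecidableRel G.Adj]
    (J : Sym2 V → ℝ) (hJ : ∀ e ∈ G.edgeSet, 0 ≤ J e) (hconn : (posGraph G J).Connected)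
    {z : V → ℂ} (hz : ∀ w, ‖z w‖ ≤ 1) {v : V} (hzv : z v = 0) :
    fugacitySum (fun σ => (isingWeight G.edgeFinset J σ : ℂ)) z ≠ 0 := by
  have hF : ∀ e ∈ G.edgeFinset, ¬ e.IsDiag := fun e he =>
    G.not_isDiag_of_mem_edgeSet (SimpleGraph.mem_edgeFinset.1 he)
  have hJ' : ∀ e ∈ G.edgeFinset, 0 ≤ J e := fun e he => hJ e (SimpleGraph.mem_edgeFinset.1 he)
  -- induction on the number of nonzero fugacities
  induction hm : (Finset.univ.filter fun w => z w ≠ 0).card using Nat.strong_induction_on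
    generalizing z with
  | _ m ih =>
  intro h0
  by_cases hall : ∀ w, z w = 0
  · have hsum : fugacitySum (fun σ => (isingWeight G.edgeFinset J σ : ℂ)) z
        = (isingWeight G.edgeFinset J (fun _ => -1) : ℂ) := by
      rw [fugacitySum, Finset.sum_eq_single (fun _ => -1)]
      · simp
      · intro σ _ hσ
        obtain ⟨w, hw⟩ := Function.ne_iff.1 hσ
        have hw1 : σ w = 1 := (Int.units_eq_one_or (σ w)).resolve_right hw
        rw [Finset.prod_eq_zero (Finset.mem_univ w) (by rw [if_pos hw1, hall w]), mul_zero]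
      · simp
    rw [hsum] at h0
    exact (Real.exp_pos _).ne' (Complex.ofReal_eq_zero.1 h0)
  · push Not at hall
    obtain ⟨w, hw⟩ := hall
    obtain ⟨p⟩ := hconn.preconnected v w
    obtain ⟨d, -, hd1, hd2⟩ := p.exists_boundary_dart {a | z a = 0} hzv hw
    have hadj := d.adj
    have hmem : s(d.snd, d.fst) ∈ G.edgeFinset := by
      rw [SimpleGraph.mem_edgeFinset, SimpleGraph.mem_edgeSet]
      exact hadj.1.symm
    have hpos : 0 < J s(d.snd, d.fst) := by rw [Sym2.eq_swap]; exact hadj.2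
    have h1 := fugacitySum_update_zero_of_bond G.edgeFinset J hF hJ' hmem hpos hz hd1 h0
    refine ih _ ?_ (z := Function.update z d.snd 0) (fun a => ?_) ?_ rfl h1
    · rw [← hm]
      refine Finset.card_lt_card ⟨fun a => ?_, fun hsub => ?_⟩
      · by_cases ha : a = d.snd
        · subst ha; simp
        · simp [Function.update_of_ne ha]
      · have := hsub (Finset.mem_filter.2 ⟨Finset.mem_univ d.snd, hd2⟩)
        simp at this
    · by_cases ha : a = d.snd
      · subst ha; simp
      · simpa [Function.update_of_ne ha] using hz a
    · by_cases ha : v = d.snd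
      · subst ha; simp
      · simpa [Function.update_of_ne ha] using hzv

/-! ### The Lee–Yang polynomial -/

open Polynomial in
/-- The Lee–Yang polynomial `∑_σ f(σ) z ^ #{u : σ_u = +1}` of a weight `f` on configurations. -/
def fugacityPoly (f : Config V → ℂ) : ℂ[X] :=
  ∑ σ : Config V, C (f σ) * X ^ (Finset.univ.filter fun u => σ u = 1).card

theorem eval_fugacityPoly (f : Config V → ℂ) (z : ℂ) :
    (fugacityPoly f).eval z = fugacitySum f fun _ => z := by
  simp only [fugacityPoly, fugacitySum, Polynomial.eval_finsetSum, Polynomial.eval_mul,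
    Polynomial.eval_C, Polynomial.eval_pow, Polynomial.eval_X]
  refine Finset.sum_congr rfl fun σ _ => ?_
  rw [Finset.prod_ite, Finset.prod_const, Finset.prod_const_one, mul_one]

theorem natDegree_fugacityPoly {f : Config V → ℂ} (hf : f (fun _ => 1) ≠ 0) :
    (fugacityPoly f).natDegree = Fintype.card V := by
  refine Polynomial.natDegree_eq_of_le_of_coeff_ne_zero ?_ ?_
  · refine Polynomial.natDegree_sum_le_of_forall_le _ _ fun σ _ => ?_
    exact (Polynomial.natDegree_C_mul_X_pow_le _ _).trans (Finset.card_le_univ _)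
  · rw [fugacityPoly, Polynomial.finsetSum_coeff, Finset.sum_eq_single (fun _ => 1)]
    · simpa [Polynomial.coeff_C_mul, Polynomial.coeff_X_pow, Finset.card_univ] using hf
    · intro σ _ hσ
      rw [Polynomial.coeff_C_mul, Polynomial.coeff_X_pow, if_neg, mul_zero]
      intro h
      apply hσ
      funext u
      have h1 := (Finset.card_eq_iff_eq_univ _).1 h.symm
      have h2 := Finset.mem_univ u
      rw [← h1] at h2
      exact (Finset.mem_filter.1 h2).2
    · simp

/-- Roots of the Lee–Yang polynomial on the unit circle are simple. Writing the polynomial as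
`R(z) + z Q(z)` with `|Q| ≤ |R|` in the closed disc and `R` without zeros there, its modulus at
`r z` is at least `(1 - r) |R(r z)|`, so it cannot vanish to second order at `z`. -/
theorem derivative_fugacityPoly_ne_zero (G : SimpleGraph V) [DecidableRel G.Adj]
    (J : Sym2 V → ℝ) (hJ : ∀ e ∈ G.edgeSet, 0 ≤ J e) (hconn : (posGraph G J).Connected)
    {z : ℂ} (hz : ‖z‖ = 1)
    (h0 : (fugacityPoly fun σ => (isingWeight G.edgeFinset J σ : ℂ)).eval z = 0) :
    (fugacityPoly fun σ => (isingWeight G.edgeFinset J σ : ℂ)).derivative.eval z ≠ 0 := by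
  intro h1
  obtain ⟨v⟩ := hconn.nonempty
  set f : Config V → ℂ := fun σ => (isingWeight G.edgeFinset J σ : ℂ) with hf
  have hLY : IsLeeYang f := isLeeYang_isingWeight _ J
    (fun e he => G.not_isDiag_of_mem_edgeSet (SimpleGraph.mem_edgeFinset.1 he))
    (fun e he => hJ e (SimpleGraph.mem_edgeFinset.1 he))
  set R : ℂ → ℂ := fun w => fugacitySum (minusPart f v) (Function.update (fun _ => w) v 1) with hR
  have hRz : R z ≠ 0 := by
    have h2 := fugacitySum_ne_zero_of_connected G J hJ hconn (v := v)
      (z := Function.update (fun _ => z) v 0) (fun w => by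
        by_cases hw : w = v
        · subst hw; simp
        · simp [Function.update_of_ne hw, hz]) (by simp)
    rw [fugacitySum_update, zero_mul, add_zero] at h2
    exact h2
  have hRcont : Continuous R :=
    (continuous_fugacitySum _).comp (Continuous.update (by fun_prop) v continuous_const)
  have hbound : ∀ r ∈ Set.Ioo (0 : ℝ) 1,
      (1 - r) * ‖R (r * z)‖ ≤ ‖(fugacityPoly f).eval (r * z)‖ := by
    intro r hr
    have hn : ‖(r * z : ℂ)‖ = r := by
      rw [norm_mul, hz, mul_one, Complex.norm_real, Real.norm_of_nonneg hr.1.le]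
    have h2 := hLY.norm_plusPart_le v (z := fun _ => r * z) (fun w => by rw [hn]; exact hr.2.le)
    rw [eval_fugacityPoly, fugacitySum_eq_add f _ v]
    set Q := fugacitySum (plusPart f v) (Function.update (fun _ => r * z) v 1)
    have h3 : ‖R (r * z)‖ ≤ ‖R (r * z) + r * z * Q‖ + ‖r * z * Q‖ := by
      have := norm_sub_le (R (r * z) + r * z * Q) (r * z * Q)
      simpa using this
    rw [norm_mul, hn] at h3
    have h4 : r * ‖Q‖ ≤ r * ‖R (r * z)‖ := mul_le_mul_of_nonneg_left h2 hr.1.le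
    change _ ≤ ‖R (r * z) + r * z * Q‖
    linarith
  have hderiv : HasDerivAt (fun r : ℝ => (fugacityPoly f).eval (r * z)) 0 1 := by
    have h2 : HasDerivAt (fun w : ℂ => (fugacityPoly f).eval (w * z))
        ((fugacityPoly f).derivative.eval ((1 : ℝ) * z) * (1 * z)) ((1 : ℝ) : ℂ) :=
      ((fugacityPoly f).hasDerivAt _).comp _ ((hasDerivAt_id _).mul_const z)
    simpa [h1] using h2.comp_ofReal
  rw [hasDerivAt_iff_tendsto_slope] at hderiv
  have hlim1 := (hderiv.mono_left (nhdsWithin_mono 1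
    (fun r (hr : r < 1) => hr.ne : Set.Iio (1 : ℝ) ⊆ {1}ᶜ))).norm
  have hlim2 : Filter.Tendsto (fun r : ℝ => ‖R (r * z)‖) (nhdsWithin 1 (Set.Iio 1))
      (nhds ‖R z‖) := by
    have h2 : Continuous fun r : ℝ => ‖R (r * z)‖ := by fun_prop
    simpa using (h2.tendsto 1).mono_left (nhdsWithin_le_nhds (s := Set.Iio 1))
  have hle : ‖R z‖ ≤ ‖(0 : ℂ)‖ := by
    refine le_of_tendsto_of_tendsto hlim2 hlim1 ?_
    filter_upwards [(Ioo_mem_nhdsLT one_pos : Set.Ioo (0 : ℝ) 1 ∈ _)] with r hr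
    have h2 := hbound r hr
    rw [slope_def_module, Complex.ofReal_one, one_mul, h0, sub_zero, norm_smul, norm_inv,
      Real.norm_eq_abs, abs_sub_comm, abs_of_pos (by linarith [hr.2]), ← div_eq_inv_mul,
      le_div_iff₀ (by linarith [hr.2])]
    linarith
  rw [norm_zero] at hle
  exact hRz (norm_le_zero_iff.1 hle)

/-! ### Elementary properties of the partition function -/

/-- The couplings `J` with `t` added on the bond `e₀`. -/
def addBond (J : Sym2 V → ℝ) (e₀ : Sym2 V) (t : ℝ) : Sym2 V → ℝ :=
  fun e => J e + if e = e₀ then t else 0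

theorem sum_spin {V : Type*} [Fintype V] (σ : Config V) :
    ∑ u, spin σ u = 2 * ((Finset.univ.filter fun u => σ u = 1).card : ℝ) - Fintype.card V := by
  have h : ∀ u, spin σ u = 2 * (if σ u = 1 then 1 else 0) - 1 := by
    intro u
    rcases Int.units_eq_one_or (σ u) with h | h
    · simp [spin, h]; norm_num
    · simp [spin, h]
  simp only [h, Finset.sum_sub_distrib, ← Finset.mul_sum, Finset.sum_boole, Finset.sum_const,
    Finset.card_univ, nsmul_eq_mul, mul_one]

section PartitionFunction

variable (G : SimpleGraph V) [DecidableRel G.Adj] (J : Sym2 V → ℝ) (e₀ : Sym2 V)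

theorem partitionFn_eq_eval (he₀ : e₀ ∈ G.edgeSet) (t : ℝ) (x : ℂ) :
    partitionFn G J e₀ t x = Complex.exp (-(Fintype.card V * x * Complex.I)) *
      (fugacityPoly fun σ => (isingWeight G.edgeFinset (addBond J e₀ t) σ : ℂ)).eval
        (Complex.exp (2 * x * Complex.I)) := by
  simp only [partitionFn, fugacityPoly, Polynomial.eval_finsetSum, Polynomial.eval_mul,
    Polynomial.eval_C, Polynomial.eval_pow, Polynomial.eval_X, Finset.mul_sum]
  refine Finset.sum_congr rfl fun σ _ => ?_
  have h1 : t * edgeSpin σ e₀ + ∑ e ∈ G.edgeFinset, J e * edgeSpin σ e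
      = ∑ e ∈ G.edgeFinset, addBond J e₀ t e * edgeSpin σ e := by
    simp only [addBond, add_mul, Finset.sum_add_distrib, ite_mul, zero_mul]
    rw [Finset.sum_ite_eq' G.edgeFinset e₀, if_pos (SimpleGraph.mem_edgeFinset.2 he₀), add_comm]
  rw [h1, sum_spin, isingWeight, Complex.ofReal_exp, ← Complex.exp_nat_mul, ← Complex.exp_add,
    ← Complex.exp_add]
  congr 1
  push_cast
  ring

theorem spin_neg {V : Type*} (σ : Config V) (u : V) : spin (-σ) u = -spin σ u := by
  simp [spin]

theorem edgeSpin_neg {V : Type*} (σ : Config V) (e : Sym2 V) : edgeSpin (-σ) e = edgeSpin σ e := by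
  induction e using Sym2.ind with
  | _ u v => simp [edgeSpin, spin_neg]

theorem partitionFn_neg (t : ℝ) (x : ℂ) :
    partitionFn G J e₀ t (-x) = partitionFn G J e₀ t x := by
  unfold partitionFn
  refine Fintype.sum_equiv (Equiv.neg _) _ _ fun σ => ?_
  simp only [Equiv.neg_apply, edgeSpin_neg, spin_neg, Finset.sum_neg_distrib]
  congr 1
  push_cast
  ring

theorem partitionFn_add_pi (he₀ : e₀ ∈ G.edgeSet) (t : ℝ) (x : ℂ) :
    partitionFn G J e₀ t (x + π) = (-1) ^ Fintype.card V * partitionFn G J e₀ t x := by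
  rw [partitionFn_eq_eval G J e₀ he₀, partitionFn_eq_eval G J e₀ he₀]
  have h1 : Complex.exp (2 * (x + π) * Complex.I) = Complex.exp (2 * x * Complex.I) := by
    rw [← Complex.exp_periodic (2 * x * Complex.I)]
    congr 1; ring
  have h2 : Complex.exp (-(Fintype.card V * (x + π) * Complex.I))
      = (-1) ^ Fintype.card V * Complex.exp (-(Fintype.card V * x * Complex.I)) := by
    have h3 : (-1 : ℂ) = Complex.exp (-(π * Complex.I)) := by
      rw [Complex.exp_neg, Complex.exp_pi_mul_I]; norm_num
    rw [h3, ← Complex.exp_nat_mul, ← Complex.exp_add]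
    congr 1; ring
  rw [h1, h2, mul_assoc]

theorem partitionFn_add_int_mul_pi_eq_zero_iff (he₀ : e₀ ∈ G.edgeSet) (t : ℝ) (x : ℂ) (m : ℤ) :
    partitionFn G J e₀ t (x + m * π) = 0 ↔ partitionFn G J e₀ t x = 0 := by
  have hstep : ∀ y : ℂ, partitionFn G J e₀ t (y + π) = 0 ↔ partitionFn G J e₀ t y = 0 := by
    intro y
    rw [partitionFn_add_pi G J e₀ he₀, mul_eq_zero, or_iff_right]
    exact pow_ne_zero _ (by norm_num)
  induction m using Int.induction_on with
  | zero => simp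
  | succ i ih =>
    refine Iff.trans ?_ ih
    rw [← hstep (x + (i : ℤ) * π)]
    congr! 2
    push_cast; ring
  | pred i ih =>
    refine Iff.trans ?_ ih
    rw [← hstep (x + ((-i - 1 : ℤ) : ℂ) * π)]
    congr! 2
    push_cast; ring

theorem conj_partitionFn (t : ℝ) (x : ℂ) :
    (starRingEnd ℂ) (partitionFn G J e₀ t x) = partitionFn G J e₀ t ((starRingEnd ℂ) x) := by
  rw [← partitionFn_neg G J e₀ t ((starRingEnd ℂ) x)]
  unfold partitionFn
  rw [map_sum]
  refine Finset.sum_congr rfl fun σ _ => ?_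
  rw [← Complex.exp_conj]
  congr 1
  simp only [map_add, map_mul, Complex.conj_ofReal, Complex.conj_I]
  ring

theorem ofReal_re_partitionFn (t y : ℝ) :
    (((partitionFn G J e₀ t y).re : ℝ) : ℂ) = partitionFn G J e₀ t y := by
  rw [← Complex.conj_eq_iff_re, conj_partitionFn, Complex.conj_ofReal]

theorem partitionFn_zero_ne_zero (t : ℝ) : partitionFn G J e₀ t 0 ≠ 0 := by
  have h : partitionFn G J e₀ t 0 = ((∑ σ : Config V,
      Real.exp (t * edgeSpin σ e₀ + ∑ e ∈ G.edgeFinset, J e * edgeSpin σ e) : ℝ) : ℂ) := by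
    simp [partitionFn]
  rw [h, Complex.ofReal_ne_zero]
  exact (Finset.sum_pos (fun σ _ => Real.exp_pos _) Finset.univ_nonempty).ne'

theorem differentiable_partitionFn (t : ℝ) : Differentiable ℂ (partitionFn G J e₀ t) := by
  unfold partitionFn
  fun_prop

theorem continuous_partitionFn_left (y : ℂ) : Continuous fun t => partitionFn G J e₀ t y := by
  unfold partitionFn
  fun_prop

/-- At a fixed field the partition function is a combination of `e^t` and `e^{-t}`, so two zeros
in `t` make it vanish identically in `t`. -/
theorem partitionFn_eq_zero_of_two_zeros (he₀ : e₀ ∈ G.edgeSet) {y : ℂ} {s t : ℝ} (hst : s ≠ t)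
    (hs : partitionFn G J e₀ s y = 0) (ht : partitionFn G J e₀ t y = 0) (r : ℝ) :
    partitionFn G J e₀ r y = 0 := by
  obtain ⟨a, b, hab⟩ : ∃ a b : ℂ, ∀ t : ℝ,
      partitionFn G J e₀ t y = Complex.exp t * a + Complex.exp (-t) * b := by
    set w : Config V → ℂ := fun σ => Complex.exp
      (((∑ e ∈ G.edgeFinset, J e * edgeSpin σ e : ℝ) : ℂ)
        + Complex.I * y * ((∑ u, spin σ u : ℝ) : ℂ)) with hw
    refine ⟨∑ σ, if edgeSpin σ e₀ = 1 then w σ else 0,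
      ∑ σ, if edgeSpin σ e₀ = 1 then 0 else w σ, fun t => ?_⟩
    rw [Finset.mul_sum, Finset.mul_sum, ← Finset.sum_add_distrib, partitionFn]
    refine Finset.sum_congr rfl fun σ _ => ?_
    have h1 : edgeSpin σ e₀ = 1 ∨ edgeSpin σ e₀ = -1 := by
      induction e₀ using Sym2.ind with
      | _ u v => rw [edgeSpin_mk]; split_ifs <;> simp
    rcases h1 with h1 | h1
    · rw [if_pos h1, if_pos h1, mul_zero, add_zero, hw, ← Complex.exp_add, h1]
      congr 1; push_cast; ring
    · rw [if_neg (by rw [h1]; norm_num), if_neg (by rw [h1]; norm_num), mul_zero, zero_add, hw,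
        ← Complex.exp_add, h1]
      congr 1; push_cast; ring
  have hprod : ∀ t : ℝ, Complex.exp (-t) * Complex.exp t = 1 := by
    intro t; rw [← Complex.exp_add]; simp
  have hzero : ∀ t : ℝ, partitionFn G J e₀ t y = 0 → (Real.exp (2 * t) : ℂ) * a + b = 0 := by
    intro t ht
    rw [hab] at ht
    have h2 : (Real.exp (2 * t) : ℂ) = Complex.exp t * Complex.exp t := by
      rw [← Complex.exp_add]; push_cast; congr 1; ring
    rw [h2]
    linear_combination Complex.exp t * ht - b * hprod t
  have hs' := hzero s hs
  have ht' := hzero t ht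
  have hne : (Real.exp (2 * s) : ℂ) - Real.exp (2 * t) ≠ 0 := by
    rw [sub_ne_zero]
    intro h
    have := Real.exp_injective (Complex.ofReal_injective h)
    exact hst (by linarith)
  have ha : a = 0 := by
    have : ((Real.exp (2 * s) : ℂ) - Real.exp (2 * t)) * a = 0 := by
      linear_combination hs' - ht'
    exact (mul_eq_zero.1 this).resolve_left hne
  have hb : b = 0 := by rw [ha] at hs'; linear_combination hs'
  rw [hab, ha, hb, mul_zero, mul_zero, add_zero]

/-! ### Reality and simplicity of the zeros -/

variable {G J e₀} (hJ : ∀ e ∈ G.edgeSet, 0 ≤ J e) (hconn : (posGraph G J).Connected)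
  (he₀ : e₀ ∈ G.edgeSet) {t : ℝ} (ht : 0 ≤ t)

theorem addBond_nonneg {V : Type*} [DecidableEq V] {G : SimpleGraph V} {J : Sym2 V → ℝ}
    {e₀ : Sym2 V} (hJ : ∀ e ∈ G.edgeSet, 0 ≤ J e) {t : ℝ}
    (ht : 0 ≤ t) : ∀ e ∈ G.edgeSet, 0 ≤ addBond J e₀ t e := by
  intro e he
  have := hJ e he
  unfold addBond
  split_ifs <;> linarith

theorem connected_addBond {V : Type*} [DecidableEq V] {G : SimpleGraph V} {J : Sym2 V → ℝ}
    {e₀ : Sym2 V} (hconn : (posGraph G J).Connected)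
    {t : ℝ} (ht : 0 ≤ t) : (posGraph G (addBond J e₀ t)).Connected := by
  refine hconn.mono fun u v (h : (posGraph G J).Adj u v) => ⟨h.1, ?_⟩
  have := h.2
  unfold addBond
  split_ifs <;> linarith

include hJ he₀ ht in
theorem im_eq_zero_of_partitionFn_eq_zero {x : ℂ} (hx : partitionFn G J e₀ t x = 0) :
    x.im = 0 := by
  have key : ∀ x : ℂ, partitionFn G J e₀ t x = 0 → x.im ≤ 0 := by
    intro x hx
    by_contra! him
    rw [partitionFn_eq_eval G J e₀ he₀, eval_fugacityPoly] at hx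
    refine (isLeeYang_isingWeight G.edgeFinset (addBond J e₀ t)
      (fun e he => G.not_isDiag_of_mem_edgeSet (SimpleGraph.mem_edgeFinset.1 he))
      (fun e he => addBond_nonneg hJ ht e (SimpleGraph.mem_edgeFinset.1 he))) _ (fun u => ?_)
      ((mul_eq_zero.1 hx).resolve_left (Complex.exp_ne_zero _))
    rw [Complex.norm_exp, Real.exp_lt_one_iff]
    simpa using him
  have h1 := key x hx
  have h2 := key (-x) (by rw [partitionFn_neg, hx])
  rw [Complex.neg_im] at h2
  linarith

include hJ hconn he₀ ht in
theorem deriv_partitionFn_ne_zero {y : ℝ} (hy : partitionFn G J e₀ t y = 0) :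
    deriv (partitionFn G J e₀ t) y ≠ 0 := by
  set p := fugacityPoly fun σ => (isingWeight G.edgeFinset (addBond J e₀ t) σ : ℂ) with hp
  have hy' : p.eval (Complex.exp (2 * y * Complex.I)) = 0 := by
    rw [partitionFn_eq_eval G J e₀ he₀] at hy
    exact (mul_eq_zero.1 hy).resolve_left (Complex.exp_ne_zero _)
  have hp' := derivative_fugacityPoly_ne_zero G (addBond J e₀ t) (addBond_nonneg hJ ht)
    (connected_addBond hconn ht) (z := Complex.exp (2 * y * Complex.I))
    (by rw [Complex.norm_exp]; simp) hy'
  have hfun : partitionFn G J e₀ t = fun x => Complex.exp (-(Fintype.card V * x * Complex.I)) *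
      p.eval (Complex.exp (2 * x * Complex.I)) := by
    funext x; exact partitionFn_eq_eval G J e₀ he₀ t x
  have h1 : HasDerivAt (fun x : ℂ => Complex.exp (2 * x * Complex.I))
      (Complex.exp (2 * y * Complex.I) * (2 * Complex.I)) (y : ℂ) := by
    have h := (((hasDerivAt_id (y : ℂ)).const_mul 2).mul_const Complex.I).cexp
    simpa using h
  have h2 : HasDerivAt (fun x : ℂ => Complex.exp (-(Fintype.card V * x * Complex.I)))
      (deriv (fun x : ℂ => Complex.exp (-(Fintype.card V * x * Complex.I))) y) (y : ℂ) :=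
    DifferentiableAt.hasDerivAt (by fun_prop)
  have h3 := h2.mul ((p.hasDerivAt _).comp (y : ℂ) h1)
  rw [hfun]
  have h4 := h3.deriv
  simp only [Function.comp_apply, hy', mul_zero, zero_add] at h4
  intro h5
  have h6 := h4.symm.trans h5
  simp only [mul_eq_zero, Complex.exp_ne_zero, Complex.I_ne_zero, OfNat.ofNat_ne_zero,
    false_or, or_false] at h6
  exact hp' h6

include hJ hconn he₀ ht in
theorem analyticOrderNatAt_partitionFn {y : ℝ} (hy : partitionFn G J e₀ t y = 0) :
    analyticOrderNatAt (partitionFn G J e₀ t) y = 1 := by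
  rw [analyticOrderNatAt, AnalyticAt.analyticOrderAt_eq_one_of_zero_deriv_ne_zero
    ((differentiable_partitionFn G J e₀ t).analyticAt _) hy
    (deriv_partitionFn_ne_zero hJ hconn he₀ ht hy)]
  rfl

/-! ### Counting the zeros -/

include hJ hconn he₀ ht in
/-- The `n` simple roots of the Lee–Yang polynomial on the unit circle, none of them equal to
`1`, give `n` zeros of the partition function in `(0, π)`. -/
theorem exists_finset_zeros : ∃ T : Finset ℝ, T.card = Fintype.card V ∧
    ∀ y : ℝ, y ∈ T ↔ (0 < y ∧ y < π) ∧ partitionFn G J e₀ t y = 0 := by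
  set p := fugacityPoly fun σ => (isingWeight G.edgeFinset (addBond J e₀ t) σ : ℂ) with hp
  have hdeg : p.natDegree = Fintype.card V :=
    natDegree_fugacityPoly (Complex.ofReal_ne_zero.2 (Real.exp_pos _).ne')
  have hp0 : p ≠ 0 := by
    intro h
    have h1 := partitionFn_zero_ne_zero G J e₀ t
    rw [partitionFn_eq_eval G J e₀ he₀, ← hp, h] at h1
    simp at h1
  have hZ : ∀ x : ℂ, partitionFn G J e₀ t x = 0
      ↔ p.eval (Complex.exp (2 * x * Complex.I)) = 0 := by
    intro x
    rw [partitionFn_eq_eval G J e₀ he₀, mul_eq_zero, or_iff_right (Complex.exp_ne_zero _)]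
  -- `θ z ∈ (0, π]` is the solution of `exp (2 i θ) = z`
  set θ : ℂ → ℝ := fun z => ((-z).arg + π) / 2 with hθ
  have hpolar : ∀ z : ℂ, z ≠ 0 →
      Complex.exp (2 * ((Real.log ‖z‖ / (2 * Complex.I) + θ z : ℂ)) * Complex.I) = z := by
    intro z hz
    have h1 : 2 * ((Real.log ‖z‖ / (2 * Complex.I) + θ z : ℂ)) * Complex.I
        = Complex.log (-z) + π * Complex.I := by
      rw [Complex.log, norm_neg, hθ]
      field_simp
      push_cast
      ring
    rw [h1, Complex.exp_add, Complex.exp_log (neg_ne_zero.2 hz), Complex.exp_pi_mul_I]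
    ring
  have hroot : ∀ z : ℂ, p.eval z = 0 → ‖z‖ = 1 := by
    intro z hz
    have hz0 : z ≠ 0 := by
      rintro rfl
      rw [hp, eval_fugacityPoly] at hz
      exact isLeeYang_isingWeight G.edgeFinset (addBond J e₀ t)
        (fun e he => G.not_isDiag_of_mem_edgeSet (SimpleGraph.mem_edgeFinset.1 he))
        (fun e he => addBond_nonneg hJ ht e (SimpleGraph.mem_edgeFinset.1 he)) _ (by simp) hz
    have h1 := hpolar z hz0
    rw [← h1, ← hZ] at hz
    have h2 := im_eq_zero_of_partitionFn_eq_zero hJ he₀ ht hz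
    rw [← h1, Complex.norm_exp, Real.exp_eq_one_iff]
    simp [Complex.mul_re, h2]
  have hexp : ∀ z : ℂ, p.eval z = 0 → Complex.exp (2 * (θ z : ℂ) * Complex.I) = z := by
    intro z hz
    have h1 := hroot z hz
    have h2 := hpolar z (by rw [← norm_ne_zero_iff, h1]; norm_num)
    rw [h1] at h2
    simpa using h2
  have hnodup : p.roots.Nodup := by
    rw [Multiset.nodup_iff_count_le_one]
    intro z
    by_contra! hlt
    rw [Polynomial.count_roots, Polynomial.one_lt_rootMultiplicity_iff_isRoot hp0] at hlt
    exact derivative_fugacityPoly_ne_zero G (addBond J e₀ t) (addBond_nonneg hJ ht)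
      (connected_addBond hconn ht) (hroot z hlt.1) hlt.1 hlt.2
  refine ⟨p.roots.toFinset.image θ, ?_, fun y => ?_⟩
  · rw [Finset.card_image_of_injOn, Multiset.toFinset_card_of_nodup hnodup,
      IsAlgClosed.card_roots_eq_natDegree, hdeg]
    intro z hz w hw hzw
    have hz' : p.eval z = 0 := (Polynomial.mem_roots'.1 (Multiset.mem_toFinset.1 hz)).2
    have hw' : p.eval w = 0 := (Polynomial.mem_roots'.1 (Multiset.mem_toFinset.1 hw)).2
    rw [← hexp z hz', ← hexp w hw', hzw]
  · rw [Finset.mem_image]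
    constructor
    · rintro ⟨z, hz, rfl⟩
      have hz' : p.eval z = 0 := (Polynomial.mem_roots'.1 (Multiset.mem_toFinset.1 hz)).2
      have h1 := Complex.neg_pi_lt_arg (-z)
      have h2 := Complex.arg_le_pi (-z)
      have h3 : partitionFn G J e₀ t (θ z : ℂ) = 0 := by rw [hZ, hexp z hz', hz']
      have h4 : θ z ≠ π := by
        intro h
        rw [h] at h3
        have h5 := (partitionFn_add_int_mul_pi_eq_zero_iff G J e₀ he₀ t 0 1).1 (by simpa using h3)
        exact partitionFn_zero_ne_zero G J e₀ t h5
      refine ⟨⟨?_, lt_of_le_of_ne ?_ h4⟩, h3⟩ <;> simp only [hθ] <;> linarith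
    · rintro ⟨⟨h0, hπ⟩, hy⟩
      refine ⟨Complex.exp (2 * y * Complex.I), ?_, ?_⟩
      · rw [Multiset.mem_toFinset, Polynomial.mem_roots hp0]
        exact (hZ _).1 hy
      · have h1 : -Complex.exp (2 * y * Complex.I)
            = Complex.exp (((2 * y - π : ℝ) : ℂ) * Complex.I) := by
          have h2 : ((2 * y - π : ℝ) : ℂ) * Complex.I = 2 * y * Complex.I - π * Complex.I := by
            push_cast; ring
          rw [h2, Complex.exp_sub, Complex.exp_pi_mul_I]
          ring
        simp only [hθ]
        rw [h1, Complex.arg_exp_mul_I, (toIocMod_eq_self _).2 ⟨by linarith, by linarith⟩]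
        ring

include he₀ in
theorem partitionFn_pi_sub_eq_zero_iff (t : ℝ) (y : ℂ) :
    partitionFn G J e₀ t (π - y) = 0 ↔ partitionFn G J e₀ t y = 0 := by
  rw [← partitionFn_neg G J e₀ t y, ← partitionFn_add_int_mul_pi_eq_zero_iff G J e₀ he₀ t (-y) 1]
  congr! 2
  push_cast; ring

include hJ hconn he₀ ht in
/-- By the symmetry `y ↦ π - y`, half of the zeros in `(0, π)` lie below `π / 2`, which is itself
a zero precisely when their number is odd. -/
theorem exists_finset_zeros_lt_half_pi :
    (∃ B : Finset ℝ, B.card = Fintype.card V / 2 ∧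
      ∀ y : ℝ, y ∈ B ↔ (0 < y ∧ y < π / 2) ∧ partitionFn G J e₀ t y = 0) ∧
    (partitionFn G J e₀ t ((π / 2 : ℝ) : ℂ) = 0 ↔ Odd (Fintype.card V)) := by
  obtain ⟨T, hTcard, hT⟩ := exists_finset_zeros hJ hconn he₀ ht
  have hsymm : (T.filter (· < π / 2)).card = (T.filter (π / 2 < ·)).card := by
    have hrefl : ∀ y ∈ T, π - y ∈ T := by
      intro y hy
      rw [hT] at hy ⊢
      refine ⟨⟨by linarith [hy.1.2], by linarith [hy.1.1]⟩, ?_⟩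
      rw [Complex.ofReal_sub, partitionFn_pi_sub_eq_zero_iff he₀]
      exact hy.2
    refine Finset.card_nbij' (fun y => π - y) (fun y => π - y) ?_ ?_ ?_ ?_
    · intro y hy
      simp only [Finset.coe_filter, Set.mem_ofPred_eq] at hy ⊢
      exact ⟨hrefl y hy.1, by linarith [hy.2]⟩
    · intro y hy
      simp only [Finset.coe_filter, Set.mem_ofPred_eq] at hy ⊢
      exact ⟨hrefl y hy.1, by linarith [hy.2]⟩
    · intro y _; simp
    · intro y _; simp
  have h1 := Finset.card_filter_add_card_filter_not (s := T) (· < π / 2)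
  have h2 := Finset.card_filter_add_card_filter_not (s := T.filter fun y => ¬ y < π / 2) (π / 2 < ·)
  rw [Finset.filter_filter, Finset.filter_filter] at h2
  have h3 : T.filter (fun y => ¬ y < π / 2 ∧ π / 2 < y) = T.filter (π / 2 < ·) := by
    refine Finset.filter_congr fun y _ => ⟨fun h => h.2, fun h => ⟨not_lt.2 h.le, h⟩⟩
  have h4 : T.filter (fun y => ¬ y < π / 2 ∧ ¬ π / 2 < y) = T.filter (fun y => y = π / 2) := by
    refine Finset.filter_congr fun y _ => ⟨fun h => ?_, fun h => by simp [h]⟩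
    exact le_antisymm (not_lt.1 h.2) (not_lt.1 h.1)
  have hmid : π / 2 ∈ T ↔ partitionFn G J e₀ t ((π / 2 : ℝ) : ℂ) = 0 := by
    rw [hT, and_iff_right]
    constructor <;> linarith [Real.pi_pos]
  rw [h3, h4, Finset.filter_eq'] at h2
  rw [← hTcard, ← hmid]
  have h5 : (if π / 2 ∈ T then {π / 2} else (∅ : Finset ℝ)).card = if π / 2 ∈ T then 1 else 0 := by
    split_ifs <;> simp
  rw [h5] at h2
  refine ⟨⟨T.filter (· < π / 2), ?_, fun y => ?_⟩, ?_⟩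
  · split_ifs at h2 <;> omega
  · rw [Finset.mem_filter, hT]
    constructor
    · rintro ⟨⟨⟨a, b⟩, c⟩, d⟩; exact ⟨⟨a, d⟩, c⟩
    · rintro ⟨⟨a, b⟩, c⟩; exact ⟨⟨⟨a, by linarith [Real.pi_pos]⟩, c⟩, b⟩
  · rw [Nat.odd_iff]
    split_ifs at h2 with h <;> simp only [h, true_iff, false_iff] <;> omega

end PartitionFunction

/-! ### Listing simple zeros in increasing order -/

theorem zeroCount_eq_card {f : ℂ → ℂ} {A : Finset ℝ} {c : ℝ}
    (hA : ∀ y : ℝ, y ∈ A ↔ (0 < y ∧ y ≤ c) ∧ f y = 0)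
    (hord : ∀ y ∈ A, analyticOrderNatAt f (y : ℂ) = 1) {r : ℝ} (hr : r ≤ c) :
    zeroCount f r = (A.filter (· ≤ r)).card := by
  rw [zeroCount, finsum_mem_eq_sum_of_inter_support_eq _ (t := A.filter (· ≤ r)),
    Finset.sum_congr rfl fun y hy => hord y (Finset.mem_filter.1 hy).1, Finset.card_eq_sum_ones]
  ext y
  simp only [Set.mem_inter_iff, Set.mem_Ioc, Function.mem_support, Finset.coe_filter,
    Set.mem_ofPred_eq, and_congr_left_iff, hA]
  intro hy
  have := apply_eq_zero_of_analyticOrderNatAt_ne_zero hy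
  exact fun h1 => ⟨fun h0 => ⟨⟨h0, h1.trans hr⟩, this⟩, fun h => h.1.1⟩

/-- If the zeros of `f` in `(0, c]` are simple, `posZero` lists them in increasing order. -/
theorem posZero_eq_orderEmbOfFin {f : ℂ → ℂ} {A : Finset ℝ} {c : ℝ}
    (hA : ∀ y : ℝ, y ∈ A ↔ (0 < y ∧ y ≤ c) ∧ f y = 0)
    (hord : ∀ y ∈ A, analyticOrderNatAt f (y : ℂ) = 1) {N : ℕ} (hN : A.card = N) (i : Fin N) :
    posZero f (i + 1) = A.orderEmbOfFin hN i := by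
  have hi := (hA _).1 (A.orderEmbOfFin_mem hN i)
  refine IsLeast.csInf_eq ⟨⟨hi.1.1, ?_⟩, fun r hr => ?_⟩
  · rw [zeroCount_eq_card hA hord hi.1.2, ← Fin.card_Iic i,
      ← Finset.card_map (A.orderEmbOfFin hN).toEmbedding]
    refine Finset.card_le_card fun y hy => ?_
    obtain ⟨j, hj, rfl⟩ := Finset.mem_map.1 hy
    rw [Finset.mem_filter]
    exact ⟨A.orderEmbOfFin_mem hN j, (A.orderEmbOfFin hN).monotone (Finset.mem_Iic.1 hj)⟩
  · by_contra! hlt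
    have h1 := hr.2
    rw [zeroCount_eq_card hA hord (hlt.le.trans hi.1.2)] at h1
    have h2 : (A.filter (· ≤ r)).card ≤ i := by
      rw [← Fin.card_Iio i, ← Finset.card_map (A.orderEmbOfFin hN).toEmbedding]
      refine Finset.card_le_card fun y hy => ?_
      rw [Finset.mem_filter] at hy
      obtain ⟨j, rfl⟩ : y ∈ Set.range (A.orderEmbOfFin hN) := by
        rw [Finset.range_orderEmbOfFin]; exact hy.1
      exact Finset.mem_map.2 ⟨j, Finset.mem_Iio.2
        ((A.orderEmbOfFin hN).lt_iff_lt.1 (hy.2.trans_lt hlt)), rfl⟩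
    omega

/-- A finite set of `M` reals has only one increasing enumeration by `1, …, M`. -/
theorem eqOn_of_strictMonoOn_of_card {B : Finset ℝ} {M : ℕ} (hB : B.card = M) {a b : ℕ → ℝ}
    (ha : ∀ k ∈ Set.Icc 1 M, a k ∈ B) (hb : ∀ k ∈ Set.Icc 1 M, b k ∈ B)
    (ham : StrictMonoOn a (Set.Icc 1 M)) (hbm : StrictMonoOn b (Set.Icc 1 M)) :
    ∀ k ∈ Set.Icc 1 M, a k = b k := by
  have key : ∀ a : ℕ → ℝ, (∀ k ∈ Set.Icc 1 M, a k ∈ B) → StrictMonoOn a (Set.Icc 1 M) →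
      (fun i : Fin M => a (i + 1)) = B.orderEmbOfFin hB := by
    intro a ha ham
    have hmem : ∀ i : Fin M, (i : ℕ) + 1 ∈ Set.Icc 1 M := fun i => ⟨by omega, i.2⟩
    exact Finset.orderEmbOfFin_unique hB (fun i => ha _ (hmem i))
      (fun i j hij => ham (hmem i) (hmem j) (by simpa using hij))
  intro k hk
  have h1 := congrFun ((key a ha ham).trans (key b hb hbm).symm) ⟨k - 1, by
    have := hk.1; have := hk.2; omega⟩
  simpa [Nat.sub_add_cancel hk.1] using h1

/-! ### The zeros in `(0, π / 2]` -/

section Zeros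

variable {G : SimpleGraph V} [DecidableRel G.Adj] {J : Sym2 V → ℝ} {e₀ : Sym2 V}
  (hJ : ∀ e ∈ G.edgeSet, 0 ≤ J e) (hconn : (posGraph G J).Connected)
  (he₀ : e₀ ∈ G.edgeSet) {t : ℝ} (ht : 0 ≤ t)

include hJ hconn he₀ ht in
theorem exists_enumeration : ∃ A : Finset ℝ, ∃ hA : A.card = (Fintype.card V + 1) / 2,
    (∀ y : ℝ, y ∈ A ↔ (0 < y ∧ y ≤ π / 2) ∧ partitionFn G J e₀ t y = 0) ∧
    ∀ i : Fin ((Fintype.card V + 1) / 2),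
      isingZero G J e₀ (i + 1) t = A.orderEmbOfFin hA i := by
  obtain ⟨⟨B, hBcard, hB⟩, hodd⟩ := exists_finset_zeros_lt_half_pi hJ hconn he₀ ht
  obtain ⟨A, hA, hAmem⟩ : ∃ A : Finset ℝ, A.card = (Fintype.card V + 1) / 2 ∧
      ∀ y : ℝ, y ∈ A ↔ (0 < y ∧ y ≤ π / 2) ∧ partitionFn G J e₀ t y = 0 := by
    by_cases h : Odd (Fintype.card V)
    · refine ⟨insert (π / 2) B, ?_, fun y => ?_⟩
      · rw [Finset.card_insert_of_notMem (by rw [hB]; simp), hBcard]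
        obtain ⟨m, hm⟩ := h
        omega
      · rw [Finset.mem_insert, hB]
        constructor
        · rintro (rfl | ⟨⟨h0, h1⟩, h2⟩)
          · exact ⟨⟨Real.pi_div_two_pos, le_rfl⟩, hodd.2 h⟩
          · exact ⟨⟨h0, h1.le⟩, h2⟩
        · rintro ⟨⟨h0, h1⟩, h2⟩
          rcases h1.eq_or_lt with h1 | h1
          · exact Or.inl h1
          · exact Or.inr ⟨⟨h0, h1⟩, h2⟩
    · refine ⟨B, ?_, fun y => ?_⟩
      · rw [hBcard]
        obtain ⟨m, hm⟩ := Nat.not_odd_iff_even.1 h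
        omega
      · rw [hB]
        constructor
        · rintro ⟨⟨h0, h1⟩, h2⟩; exact ⟨⟨h0, h1.le⟩, h2⟩
        · rintro ⟨⟨h0, h1⟩, h2⟩
          refine ⟨⟨h0, lt_of_le_of_ne h1 ?_⟩, h2⟩
          rintro rfl
          exact h (hodd.1 h2)
  exact ⟨A, hA, hAmem, posZero_eq_orderEmbOfFin hAmem
    (fun y hy => analyticOrderNatAt_partitionFn hJ hconn he₀ ht ((hAmem y).1 hy).2) hA⟩

include hJ hconn he₀ ht in
theorem isingZero_spec {k : ℕ} (hk : k ∈ Set.Icc 1 ((Fintype.card V + 1) / 2)) :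
    (0 < isingZero G J e₀ k t ∧ isingZero G J e₀ k t ≤ π / 2) ∧
      partitionFn G J e₀ t (isingZero G J e₀ k t) = 0 := by
  obtain ⟨A, hA, hAmem, hx⟩ := exists_enumeration hJ hconn he₀ ht
  have h1 := hx ⟨k - 1, by have := hk.1; have := hk.2; omega⟩
  simp only [Nat.sub_add_cancel hk.1] at h1
  rw [h1, ← hAmem]
  exact A.orderEmbOfFin_mem hA _

include hJ hconn he₀ ht in
theorem strictMonoOn_isingZero :
    StrictMonoOn (fun k => isingZero G J e₀ k t) (Set.Icc 1 ((Fintype.card V + 1) / 2)) := by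
  obtain ⟨A, hA, hAmem, hx⟩ := exists_enumeration hJ hconn he₀ ht
  intro j hj k hk hjk
  have h1 := hx ⟨j - 1, by have := hj.1; have := hj.2; omega⟩
  have h2 := hx ⟨k - 1, by have := hk.1; have := hk.2; omega⟩
  simp only [Nat.sub_add_cancel hj.1, Nat.sub_add_cancel hk.1] at h1 h2
  simp only [h1, h2, OrderEmbedding.lt_iff_lt, Fin.mk_lt_mk]
  have := hj.1
  omega

include hJ hconn he₀ ht in
theorem exists_isingZero_eq {y : ℝ} (hy0 : 0 < y) (hy1 : y ≤ π / 2)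
    (hy : partitionFn G J e₀ t y = 0) :
    ∃ k ∈ Set.Icc 1 ((Fintype.card V + 1) / 2), isingZero G J e₀ k t = y := by
  obtain ⟨A, hA, hAmem, hx⟩ := exists_enumeration hJ hconn he₀ ht
  obtain ⟨i, hi⟩ : y ∈ Set.range (A.orderEmbOfFin hA) := by
    rw [Finset.range_orderEmbOfFin]; exact (hAmem y).2 ⟨⟨hy0, hy1⟩, hy⟩
  exact ⟨i + 1, ⟨by omega, i.2⟩, (hx i).trans hi⟩

include hJ hconn he₀ ht in
theorem isingZero_eq_half_pi (hodd : Odd (Fintype.card V)) :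
    isingZero G J e₀ ((Fintype.card V + 1) / 2) t = π / 2 := by
  obtain ⟨k, hk, hkx⟩ := exists_isingZero_eq hJ hconn he₀ ht Real.pi_div_two_pos le_rfl
    ((exists_finset_zeros_lt_half_pi hJ hconn he₀ ht).2.2 hodd)
  have hN : (Fintype.card V + 1) / 2 ∈ Set.Icc 1 ((Fintype.card V + 1) / 2) :=
    ⟨hk.1.trans hk.2, le_rfl⟩
  refine le_antisymm (isingZero_spec hJ hconn he₀ ht hN).1.2 ?_
  rw [← hkx]
  exact (strictMonoOn_isingZero hJ hconn he₀ ht).monotoneOn hk hN hk.2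

include hJ hconn he₀ ht in
theorem isingZero_lt_half_pi {k : ℕ} (hk : k ∈ Set.Icc 1 (Fintype.card V / 2)) :
    isingZero G J e₀ k t < π / 2 := by
  have hk' : k ∈ Set.Icc 1 ((Fintype.card V + 1) / 2) := ⟨hk.1, by have := hk.2; omega⟩
  obtain ⟨⟨-, h1⟩, h2⟩ := isingZero_spec hJ hconn he₀ ht hk'
  refine lt_of_le_of_ne h1 fun h => ?_
  rw [h] at h2
  have hodd := (exists_finset_zeros_lt_half_pi hJ hconn he₀ ht).2.1 h2
  have h3 := strictMonoOn_isingZero hJ hconn he₀ ht hk'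
    (b := (Fintype.card V + 1) / 2) ⟨hk'.1.trans hk'.2, le_rfl⟩ (by
      obtain ⟨m, hm⟩ := hodd
      have := hk.2; omega)
  simp only [h, isingZero_eq_half_pi hJ hconn he₀ ht hodd, lt_irrefl] at h3

include hJ hconn he₀ ht in
theorem partitionFn_eq_zero_iff (z : ℂ) : partitionFn G J e₀ t z = 0 ↔
    ∃ k ∈ Set.Icc 1 ((Fintype.card V + 1) / 2), ∃ m : ℤ,
      z = (isingZero G J e₀ k t : ℂ) + m * (π : ℂ) ∨
        z = -(isingZero G J e₀ k t : ℂ) + m * (π : ℂ) := by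
  constructor
  · intro hz
    have him := im_eq_zero_of_partitionFn_eq_zero hJ he₀ ht hz
    obtain ⟨y, rfl⟩ : ∃ y : ℝ, z = y := ⟨z.re, Complex.ext rfl (by simpa using him)⟩
    -- reduce `y` modulo `π` to a zero `w` in `[0, π)`
    set m := toIcoDiv Real.pi_pos 0 y
    set w := toIcoMod Real.pi_pos 0 y
    have hw : w ∈ Set.Ico (0 : ℝ) (0 + π) := toIcoMod_mem_Ico _ _ _
    have hyw : y = w + m * π := by
      have := toIcoMod_add_toIcoDiv_zsmul Real.pi_pos 0 y
      rw [zsmul_eq_mul] at this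
      exact this.symm
    rw [hyw] at hz ⊢
    push_cast at hz ⊢
    rw [partitionFn_add_int_mul_pi_eq_zero_iff G J e₀ he₀] at hz
    have hw0 : 0 < w := by
      refine lt_of_le_of_ne hw.1 fun h => ?_
      rw [← h] at hz
      exact partitionFn_zero_ne_zero G J e₀ t (by simpa using hz)
    rcases le_or_gt w (π / 2) with h | h
    · obtain ⟨k, hk, hkx⟩ := exists_isingZero_eq hJ hconn he₀ ht hw0 h hz
      exact ⟨k, hk, m, Or.inl (by rw [hkx])⟩
    · obtain ⟨k, hk, hkx⟩ := exists_isingZero_eq hJ hconn he₀ ht (y := π - w)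
        (by linarith [hw.2]) (by linarith)
        (by push_cast; exact (partitionFn_pi_sub_eq_zero_iff he₀ t w).2 hz)
      refine ⟨k, hk, m + 1, Or.inr ?_⟩
      rw [hkx]; push_cast; ring
  · rintro ⟨k, hk, m, rfl | rfl⟩
    · rw [partitionFn_add_int_mul_pi_eq_zero_iff G J e₀ he₀]
      exact (isingZero_spec hJ hconn he₀ ht hk).2
    · rw [partitionFn_add_int_mul_pi_eq_zero_iff G J e₀ he₀, partitionFn_neg]
      exact (isingZero_spec hJ hconn he₀ ht hk).2

include hJ hconn he₀ ht in
theorem exists_hasDerivAt_re_partitionFn {y : ℝ} (hy : partitionFn G J e₀ t y = 0) :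
    ∃ d : ℝ, d ≠ 0 ∧ HasDerivAt (fun y : ℝ => (partitionFn G J e₀ t y).re) d y := by
  have h1 := (differentiable_partitionFn G J e₀ t y).hasDerivAt
  have h2 := h1.real_of_complex
  have h3 := h2.ofReal_comp
  simp only [ofReal_re_partitionFn] at h3
  refine ⟨_, fun h => deriv_partitionFn_ne_zero hJ hconn he₀ ht hy ?_, h2⟩
  rw [h1.comp_ofReal.unique h3, h, Complex.ofReal_zero]

end Zeros

/-! ### Continuity of the trajectories -/

theorem exists_sign_change {h : ℝ → ℝ} {d x : ℝ} (hd : d ≠ 0) (hh : HasDerivAt h d x)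
    (hx : h x = 0) {δ : ℝ} (hδ : 0 < δ) :
    ∃ a ∈ Set.Ioo (x - δ) x, ∃ b ∈ Set.Ioo x (x + δ), h a * h b < 0 := by
  rw [hasDerivAt_iff_tendsto_slope] at hh
  have h1 : ∀ᶠ y in nhdsWithin x {x}ᶜ, 0 < d * slope h x y := by
    refine (hh.const_mul d).eventually_const_lt ?_
    exact mul_self_pos.2 hd
  have hl : ∀ᶠ y in nhdsWithin x (Set.Iio x), 0 < d * slope h x y :=
    h1.filter_mono (nhdsWithin_mono x fun y (hy : y < x) => hy.ne)
  have hr : ∀ᶠ y in nhdsWithin x (Set.Ioi x), 0 < d * slope h x y :=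
    h1.filter_mono (nhdsWithin_mono x fun y (hy : x < y) => hy.ne')
  obtain ⟨a, ha, ha'⟩ := (hl.and (Ioo_mem_nhdsLT (by linarith : x - δ < x))).exists
  obtain ⟨b, hb, hb'⟩ := (hr.and (Ioo_mem_nhdsGT (by linarith : x < x + δ))).exists
  refine ⟨a, ha', b, hb', ?_⟩
  rw [slope_def_field, hx, sub_zero] at ha hb
  have h2 : d * h a < 0 := by
    have h3 := mul_neg_of_pos_of_neg ha (sub_neg.2 ha'.2)
    rwa [mul_assoc, div_mul_cancel₀ _ (sub_neg.2 ha'.2).ne] at h3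
  have h4 : 0 < d * h b := by
    have h3 := mul_pos hb (sub_pos.2 hb'.1)
    rwa [mul_assoc, div_mul_cancel₀ _ (sub_pos.2 hb'.1).ne'] at h3
  have h5 : (d * h a) * (d * h b) < 0 := mul_neg_of_neg_of_pos h2 h4
  have h6 : 0 < d * d := mul_self_pos.2 hd
  by_contra! h7
  nlinarith [mul_nonneg h6.le h7]

theorem exists_zero_of_mul_neg {h : ℝ → ℝ} (hh : Continuous h) {a b : ℝ} (hab : a < b)
    (hneg : h a * h b < 0) : ∃ y ∈ Set.Icc a b, h y = 0 := by
  rcases mul_neg_iff.1 hneg with ⟨h1, h2⟩ | ⟨h1, h2⟩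
  · exact intermediate_value_Icc' hab.le hh.continuousOn ⟨h2.le, h1.le⟩
  · exact intermediate_value_Icc hab.le hh.continuousOn ⟨h1.le, h2.le⟩

section Trajectories

variable {G : SimpleGraph V} [DecidableRel G.Adj] {J : Sym2 V → ℝ} {e₀ : Sym2 V}
  (hJ : ∀ e ∈ G.edgeSet, 0 ≤ J e) (hconn : (posGraph G J).Connected)
  (he₀ : e₀ ∈ G.edgeSet)

include hJ hconn he₀ in
/-- Near `t₀` each of the `⌊n/2⌋` simple zeros in `(0, π/2)` survives in a small interval around
its position at `t₀`, by a sign change. Since their total number is constant, these are all the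
zeros, in the same order. -/
theorem continuousOn_isingZero_of_le {k : ℕ} (hk : k ∈ Set.Icc 1 (Fintype.card V / 2)) :
    ContinuousOn (isingZero G J e₀ k) (Set.Ici 0) := by
  set M := Fintype.card V / 2 with hM
  have hsub : ∀ j ∈ Set.Icc 1 M, j ∈ Set.Icc 1 ((Fintype.card V + 1) / 2) :=
    fun j hj => ⟨hj.1, by have := hj.2; omega⟩
  intro t₀ ht₀
  rw [Metric.continuousWithinAt_iff']
  intro ε hε
  set p : ℕ → ℝ := fun j => isingZero G J e₀ j t₀ with hp
  have hpos : ∀ j ∈ Finset.Icc 1 M, 0 < p j := fun j hj =>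
    (isingZero_spec hJ hconn he₀ ht₀ (hsub j (Finset.mem_Icc.1 hj))).1.1
  have hlt : ∀ j ∈ Finset.Icc 1 M, p j < π / 2 := fun j hj =>
    isingZero_lt_half_pi hJ hconn he₀ ht₀ (Finset.mem_Icc.1 hj)
  -- a radius for which the intervals around the zeros are disjoint and lie in `(0, π / 2)`
  obtain ⟨δ, ⟨hδ1, hδ2⟩, hδε, hδ0⟩ : ∃ δ : ℝ, ((∀ j ∈ Finset.Icc 1 M, δ < p j ∧ δ < π / 2 - p j) ∧
      ∀ i ∈ Finset.Icc 1 M, ∀ j ∈ Finset.Icc 1 M, i < j → δ + δ < p j - p i) ∧ δ < ε ∧ 0 < δ := by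
    have hsmall : ∀ c : ℝ, 0 < c → ∀ᶠ δ in nhdsWithin (0 : ℝ) (Set.Ioi 0), δ < c := fun c hc =>
      nhdsWithin_le_nhds (Iio_mem_nhds hc)
    refine Filter.Eventually.exists (f := nhdsWithin (0 : ℝ) (Set.Ioi 0)) ?_
    refine Filter.Eventually.and (Filter.Eventually.and ?_ ?_)
      ((hsmall ε hε).and self_mem_nhdsWithin)
    · rw [Filter.eventually_all_finset]
      intro j hj
      exact (hsmall _ (hpos j hj)).and (hsmall _ (sub_pos.2 (hlt j hj)))
    · rw [Filter.eventually_all_finset]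
      intro i hi
      rw [Filter.eventually_all_finset]
      intro j hj
      by_cases hij : i < j
      · have h1 : p i < p j := strictMonoOn_isingZero hJ hconn he₀ ht₀
          (hsub i (Finset.mem_Icc.1 hi)) (hsub j (Finset.mem_Icc.1 hj)) hij
        filter_upwards [hsmall ((p j - p i) / 2) (by linarith)] with δ hδ _
        linarith
      · exact Filter.Eventually.of_forall fun δ h => absurd h hij
  have hnear : ∀ᶠ t in nhds t₀, ∀ j ∈ Finset.Icc 1 M,
      ∃ y ∈ Set.Ioo (p j - δ) (p j + δ), partitionFn G J e₀ t (y : ℝ) = 0 := by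
    rw [Filter.eventually_all_finset]
    intro j hj
    have hz := (isingZero_spec hJ hconn he₀ ht₀ (hsub j (Finset.mem_Icc.1 hj))).2
    obtain ⟨d, hd, hderiv⟩ := exists_hasDerivAt_re_partitionFn hJ hconn he₀ ht₀ hz
    obtain ⟨a, ha, b, hb, hab⟩ := exists_sign_change hd hderiv (by rw [hz]; rfl) hδ0
    have hcont : Continuous fun t => (partitionFn G J e₀ t a).re * (partitionFn G J e₀ t b).re :=
      (Complex.continuous_re.comp (continuous_partitionFn_left G J e₀ a)).mul
        (Complex.continuous_re.comp (continuous_partitionFn_left G J e₀ b))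
    filter_upwards [hcont.tendsto t₀ |>.eventually_lt_const hab] with t ht
    obtain ⟨y, hy, hy0⟩ := exists_zero_of_mul_neg
      (Complex.continuous_re.comp ((differentiable_partitionFn G J e₀ t).continuous.comp
        Complex.continuous_ofReal)) (ha.2.trans hb.1) ht
    refine ⟨y, ⟨ha.1.trans_le hy.1, hy.2.trans_lt hb.2⟩, ?_⟩
    rw [← ofReal_re_partitionFn]
    exact congrArg Complex.ofReal hy0
  filter_upwards [nhdsWithin_le_nhds hnear, self_mem_nhdsWithin] with t hnear ht
  choose! y hy hy0 using hnear
  obtain ⟨B, hBcard, hB⟩ := (exists_finset_zeros_lt_half_pi hJ hconn he₀ ht).1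
  have heq := eqOn_of_strictMonoOn_of_card hBcard (a := fun j => isingZero G J e₀ j t) (b := y)
    (fun j hj => by
      have h1 := isingZero_spec hJ hconn he₀ ht (hsub j hj)
      exact (hB _).2 ⟨⟨h1.1.1, isingZero_lt_half_pi hJ hconn he₀ ht hj⟩, h1.2⟩)
    (fun j hj => by
      have hj' := Finset.mem_Icc.2 hj
      have h1 := hy j hj'
      have h2 := hδ1 j hj'
      exact (hB _).2 ⟨⟨by linarith [h1.1], by linarith [h1.2]⟩, hy0 j hj'⟩)
    ((strictMonoOn_isingZero hJ hconn he₀ ht).mono hsub)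
    (fun i hi j hj hij => by
      have hi' := Finset.mem_Icc.2 hi
      have hj' := Finset.mem_Icc.2 hj
      have := hδ2 i hi' j hj' hij
      linarith [(hy i hi').2, (hy j hj').1])
  have h1 := hy k (Finset.mem_Icc.2 hk)
  have h2 : isingZero G J e₀ k t = y k := heq k hk
  rw [h2, Real.dist_eq, abs_lt]
  constructor <;> linarith [h1.1, h1.2]

include hJ hconn he₀ in
theorem continuousOn_isingZero {k : ℕ} (hk : k ∈ Set.Icc 1 ((Fintype.card V + 1) / 2)) :
    ContinuousOn (isingZero G J e₀ k) (Set.Ici 0) := by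
  by_cases h : k ≤ Fintype.card V / 2
  · exact continuousOn_isingZero_of_le hJ hconn he₀ ⟨hk.1, h⟩
  · have h1 : k = (Fintype.card V + 1) / 2 := by have := hk.2; omega
    have hodd : Odd (Fintype.card V) := by
      rw [Nat.odd_iff]; have := hk.2; omega
    refine continuousOn_const.congr (f := fun _ => π / 2) fun t ht => ?_
    rw [h1]
    exact isingZero_eq_half_pi hJ hconn he₀ ht hodd

/-! ### Trajectories do not revisit a point -/

include hJ hconn he₀ in
/-- A point that is a zero for every `t ≥ 0` is occupied by the same trajectory all the time:
the closed sets of times at which the different trajectories are there partition `[0, ∞)`. -/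
theorem isingZero_eq_of_forall_eq_zero {y : ℝ} (hy : ∀ r, 0 ≤ r → partitionFn G J e₀ r y = 0)
    {j : ℕ} (hj : j ∈ Set.Icc 1 ((Fintype.card V + 1) / 2)) {s : ℝ} (hs : 0 ≤ s)
    (hsy : isingZero G J e₀ j s = y) {r : ℝ} (hr : 0 ≤ r) : isingZero G J e₀ j r = y := by
  by_contra hne
  have hy01 := (isingZero_spec hJ hconn he₀ hs hj).1
  rw [hsy] at hy01
  set N := (Fintype.card V + 1) / 2
  set C : ℕ → Set ℝ := fun i => Set.Ici 0 ∩ isingZero G J e₀ i ⁻¹' {y} with hC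
  have hclosed : ∀ i ∈ Set.Icc 1 N, IsClosed (C i) := fun i hi =>
    (continuousOn_isingZero hJ hconn he₀ hi).preimage_isClosed_of_isClosed isClosed_Ici
      isClosed_singleton
  have hex : ∀ q, 0 ≤ q → ∃ i ∈ Set.Icc 1 N, isingZero G J e₀ i q = y := fun q hq =>
    exists_isingZero_eq hJ hconn he₀ hq hy01.1 hy01.2 (hy q hq)
  set D : Set ℝ := ⋃ i ∈ (Finset.Icc 1 N).erase j, C i with hD
  have hDclosed : IsClosed D := Set.Finite.isClosed_biUnion (Finset.finite_toSet _) fun i hi =>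
    hclosed i (Finset.mem_Icc.1 (Finset.mem_of_mem_erase hi))
  have hmemD : ∀ q, 0 ≤ q → isingZero G J e₀ j q ≠ y → q ∈ D := by
    intro q hq hqy
    obtain ⟨i, hi, hiy⟩ := hex q hq
    refine Set.mem_biUnion (x := i) ?_ ⟨hq, hiy⟩
    refine Finset.mem_erase.2 ⟨?_, Finset.mem_Icc.2 hi⟩
    rintro rfl
    exact hqy hiy
  obtain ⟨q, hq, hqC, hqD⟩ := isPreconnected_closed_iff.1 (isPreconnected_Ici (a := (0 : ℝ)))
    (C j) D (hclosed j hj) hDclosed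
    (fun q hq => by
      by_cases h : isingZero G J e₀ j q = y
      · exact Or.inl ⟨hq, h⟩
      · exact Or.inr (hmemD q hq h))
    ⟨s, hs, hs, hsy⟩ ⟨r, hr, hmemD r hr hne⟩
  obtain ⟨i, hi, hiC⟩ := Set.mem_iUnion₂.1 hqD
  rw [Finset.mem_erase, Finset.mem_Icc] at hi
  exact hi.1 ((strictMonoOn_isingZero hJ hconn he₀ hq).injOn hi.2 hj
    (hiC.2.trans (Eq.symm hqC.2)))

include hJ hconn he₀ in
theorem isingZero_eq_of_revisit {j k : ℕ}
    (hj : j ∈ Set.Icc 1 ((Fintype.card V + 1) / 2)) (hk : k ∈ Set.Icc 1 ((Fintype.card V + 1) / 2))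
    {s t : ℝ} (hs : 0 ≤ s) (ht : 0 ≤ t) (hst : s ≠ t)
    (h : isingZero G J e₀ j s = isingZero G J e₀ k t) {r : ℝ} (hr : 0 ≤ r) :
    isingZero G J e₀ j r = isingZero G J e₀ j s := by
  have h1 := (isingZero_spec hJ hconn he₀ hs hj).2
  have h2 := (isingZero_spec hJ hconn he₀ ht hk).2
  rw [← h] at h2
  exact isingZero_eq_of_forall_eq_zero hJ hconn he₀
    (fun q _ => partitionFn_eq_zero_of_two_zeros G J e₀ he₀ hst h1 h2 q) hj hs rfl hr

include hJ hconn he₀ in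
theorem isingZero_ne_isingZero {j k : ℕ}
    (hj : j ∈ Set.Icc 1 ((Fintype.card V + 1) / 2)) (hk : k ∈ Set.Icc 1 ((Fintype.card V + 1) / 2))
    (hjk : j ≠ k) {s t : ℝ} (hs : 0 ≤ s) (ht : 0 ≤ t) :
    isingZero G J e₀ j s ≠ isingZero G J e₀ k t := by
  intro h
  have hinj := (strictMonoOn_isingZero hJ hconn he₀ ht).injOn
  by_cases hst : s = t
  · subst hst
    exact hjk (hinj hj hk h)
  · have h1 := isingZero_eq_of_revisit hJ hconn he₀ hj hk hs ht hst h ht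
    exact hjk (hinj hj hk (h1.trans h))

end Trajectories

/-- A continuous trajectory that is constant as soon as it revisits a point is constant or
strictly monotone; in the latter case it cannot cross a barrier that it never meets. -/
theorem trichotomy_of_revisit {x : ℝ → ℝ} (hx : ContinuousOn x (Set.Ici 0))
    (hrev : ∀ s t, 0 ≤ s → 0 ≤ t → s ≠ t → x s = x t → ∀ r, 0 ≤ r → x r = x s) {l r : ℝ}
    (hl0 : l < x 0) (hr0 : x 0 < r) (hl : ∀ t, 0 ≤ t → x t ≠ l) (hr : ∀ t, 0 ≤ t → x t ≠ r) :
    Trichotomy x l r := by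
  have hsub : ∀ t, Set.Icc 0 t ⊆ Set.Ici (0 : ℝ) := fun t => Set.Icc_subset_Ici_self
  have hlt : ∀ t, 0 ≤ t → l < x t := by
    intro t ht
    by_contra! h
    obtain ⟨q, hq, hql⟩ := intermediate_value_Icc' ht (hx.mono (hsub t)) ⟨h, hl0.le⟩
    exact hl q hq.1 hql
  have hgt : ∀ t, 0 ≤ t → x t < r := by
    intro t ht
    by_contra! h
    obtain ⟨q, hq, hqr⟩ := intermediate_value_Icc ht (hx.mono (hsub t)) ⟨hr0.le, h⟩
    exact hr q hq.1 hqr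
  have m0 : (0 : ℝ) ∈ Set.Ici (0 : ℝ) := Set.mem_Ici.2 le_rfl
  have m1 : (1 : ℝ) ∈ Set.Ici (0 : ℝ) := Set.mem_Ici.2 zero_le_one
  by_cases hconst : ∀ t, 0 ≤ t → x t = x 0
  · refine Or.inl ⟨hconst, fun h => ?_, fun h => ?_⟩
    · have := h.1 m0 m1 one_pos
      linarith [hconst 1 zero_le_one]
    · have := h.1 m0 m1 one_pos
      linarith [hconst 1 zero_le_one]
  · have hinj : Set.InjOn x (Set.Ici 0) := by
      intro s hs t ht hst
      by_contra hne
      have h := hrev s t hs ht hne hst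
      exact hconst fun q hq => (h q hq).trans (h 0 le_rfl).symm
    have hmono : ∀ T, 0 ≤ T → StrictMonoOn x (Set.Icc 0 T) ∨ StrictAntiOn x (Set.Icc 0 T) :=
      fun T hT => (hx.mono (hsub T)).strictMonoOn_of_injOn_Icc' hT (hinj.mono (hsub T))
    have hne : x 0 ≠ x 1 := fun h => zero_ne_one (hinj m0 m1 h)
    have hmem : ∀ T a : ℝ, 0 ≤ a → a ≤ T → a ∈ Set.Icc 0 T := fun T a h h' => ⟨h, h'⟩
    rcases lt_or_gt_of_ne hne with h01 | h01
    · have hm : StrictMonoOn x (Set.Ici 0) := by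
        intro a ha b hb hab
        have hT : (0 : ℝ) ≤ max b 1 := zero_le_one.trans (le_max_right _ _)
        rcases hmono _ hT with h | h
        · exact h (hmem _ a ha (hab.le.trans (le_max_left _ _))) (hmem _ b hb (le_max_left _ _)) hab
        · exact absurd (h (hmem _ 0 le_rfl hT) (hmem _ 1 zero_le_one (le_max_right _ _)) one_pos)
            h01.le.not_gt
      refine Or.inr (Or.inr ⟨hconst, fun h => ?_, hm, fun t ht => ⟨hm m0 ht.le ht, hgt t ht.le⟩⟩)
      exact absurd (h.1 m0 m1 one_pos) h01.le.not_gt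
    · have hm : StrictAntiOn x (Set.Ici 0) := by
        intro a ha b hb hab
        have hT : (0 : ℝ) ≤ max b 1 := zero_le_one.trans (le_max_right _ _)
        rcases hmono _ hT with h | h
        · exact absurd (h (hmem _ 0 le_rfl hT) (hmem _ 1 zero_le_one (le_max_right _ _)) one_pos)
            h01.le.not_gt
        · exact h (hmem _ a ha (hab.le.trans (le_max_left _ _))) (hmem _ b hb (le_max_left _ _)) hab
      refine Or.inr (Or.inl ⟨hconst, ⟨hm, fun t ht => ⟨hlt t ht.le, hm m0 ht.le ht⟩⟩, fun h => ?_⟩)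
      exact absurd (h.1 m0 m1 one_pos) h01.le.not_gt

end LeeYang

end

theorem theorem1 {V : Type*} [Fintype V] [DecidableEq V] (G : SimpleGraph V)
    [DecidableRel G.Adj] (J : Sym2 V → ℝ) (hJ : ∀ e ∈ G.edgeSet, 0 ≤ J e)
    (hconn : (LeeYang.posGraph G J).Connected)
    (e₀ : Sym2 V) (he₀ : e₀ ∈ G.edgeSet)
    (n : ℕ) (hn : n = Fintype.card V)
    (x : ℕ → ℝ → ℝ) (hx : x = LeeYang.isingZero G J e₀) :
    -- the zeros of `Z_t` are the points `± x_k(t) + m π`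
    (∀ t : ℝ, 0 ≤ t → ∀ z : ℂ, LeeYang.partitionFn G J e₀ t z = 0 ↔
      ∃ k ∈ Set.Icc 1 ((n + 1) / 2), ∃ m : ℤ,
        z = (x k t : ℂ) + m * (π : ℂ) ∨ z = -(x k t : ℂ) + m * (π : ℂ)) ∧
    -- the case of even `n`
    (Even n →
      (∀ t : ℝ, 0 ≤ t →
        0 < x 1 t ∧ StrictMonoOn (fun k => x k t) (Set.Icc 1 (n / 2)) ∧ x (n / 2) t < π / 2) ∧
      (∀ k ∈ Set.Icc 1 (n / 2),
        LeeYang.Trichotomy (x k)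
          (if k = 1 then 0 else x (k - 1) 0)
          (if k = n / 2 then π / 2 else x (k + 1) 0))) ∧
    -- the case of odd `n`
    (Odd n →
      (∀ t : ℝ, 0 ≤ t →
        0 < x 1 t ∧ StrictMonoOn (fun k => x k t) (Set.Icc 1 ((n + 1) / 2)) ∧
          x ((n + 1) / 2) t = π / 2) ∧
      (∀ k ∈ Set.Icc 1 ((n - 1) / 2),
        LeeYang.Trichotomy (x k)
          (if k = 1 then 0 else x (k - 1) 0)
          (x (k + 1) 0))) ∧
    -- distinct zeros have disjoint trajectories
    (∀ j ∈ Set.Icc 1 ((n + 1) / 2), ∀ k ∈ Set.Icc 1 ((n + 1) / 2), j ≠ k →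
      Disjoint (x j '' Set.Ici 0) (x k '' Set.Ici 0)) := by
  subst hn hx
  have htri : ∀ k ∈ Set.Icc 1 (Fintype.card V / 2), ∀ r : ℝ,
      LeeYang.isingZero G J e₀ k 0 < r → (∀ t, 0 ≤ t → LeeYang.isingZero G J e₀ k t ≠ r) →
      LeeYang.Trichotomy (LeeYang.isingZero G J e₀ k)
        (if k = 1 then 0 else LeeYang.isingZero G J e₀ (k - 1) 0) r := by
    intro k hk r hr0 hr
    have hk1 := hk.1
    have hk2 := hk.2
    have hkN : k ∈ Set.Icc 1 ((Fintype.card V + 1) / 2) := ⟨hk1, by omega⟩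
    have hrev : ∀ s t, 0 ≤ s → 0 ≤ t → s ≠ t →
        LeeYang.isingZero G J e₀ k s = LeeYang.isingZero G J e₀ k t →
        ∀ r, 0 ≤ r → LeeYang.isingZero G J e₀ k r = LeeYang.isingZero G J e₀ k s :=
      fun s t hs ht hst h r hr =>
        LeeYang.isingZero_eq_of_revisit hJ hconn he₀ hkN hkN hs ht hst h hr
    have hcont := LeeYang.continuousOn_isingZero hJ hconn he₀ hkN
    split_ifs with h
    · exact LeeYang.trichotomy_of_revisit hcont hrev
        (LeeYang.isingZero_spec hJ hconn he₀ le_rfl hkN).1.1 hr0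
        (fun t ht => (LeeYang.isingZero_spec hJ hconn he₀ ht hkN).1.1.ne') hr
    · have hk' : k - 1 ∈ Set.Icc 1 ((Fintype.card V + 1) / 2) := ⟨by omega, by omega⟩
      exact LeeYang.trichotomy_of_revisit hcont hrev
        (LeeYang.strictMonoOn_isingZero hJ hconn he₀ le_rfl hk' hkN (by omega)) hr0
        (fun t ht => LeeYang.isingZero_ne_isingZero hJ hconn he₀ hkN hk' (by omega) ht le_rfl) hr
  have hnext : ∀ k ∈ Set.Icc 1 (Fintype.card V / 2), k + 1 ≤ (Fintype.card V + 1) / 2 →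
      LeeYang.Trichotomy (LeeYang.isingZero G J e₀ k)
        (if k = 1 then 0 else LeeYang.isingZero G J e₀ (k - 1) 0)
        (LeeYang.isingZero G J e₀ (k + 1) 0) := by
    intro k hk hk'
    have hkN : k ∈ Set.Icc 1 ((Fintype.card V + 1) / 2) := ⟨hk.1, by omega⟩
    have hkN' : k + 1 ∈ Set.Icc 1 ((Fintype.card V + 1) / 2) := ⟨by omega, hk'⟩
    exact htri k hk _
      (LeeYang.strictMonoOn_isingZero hJ hconn he₀ le_rfl hkN hkN' (by omega))
      (fun t ht => LeeYang.isingZero_ne_isingZero hJ hconn he₀ hkN hkN' (by omega) ht le_rfl)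
  have hcard : 2 ≤ Fintype.card V := by
    induction e₀ using Sym2.ind with
    | _ u v =>
      have huv : u ≠ v := G.ne_of_adj he₀
      exact Fintype.one_lt_card_iff.2 ⟨u, v, huv⟩
  refine ⟨fun t ht z => LeeYang.partitionFn_eq_zero_iff hJ hconn he₀ ht z, ?_, ?_, ?_⟩
  · intro heven
    refine ⟨fun t ht => ⟨?_, ?_, ?_⟩, fun k hk => ?_⟩
    · exact (LeeYang.isingZero_spec hJ hconn he₀ ht ⟨le_rfl, by omega⟩).1.1
    · exact (LeeYang.strictMonoOn_isingZero hJ hconn he₀ ht).mono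
        (Set.Icc_subset_Icc_right (by omega))
    · exact LeeYang.isingZero_lt_half_pi hJ hconn he₀ ht ⟨by omega, le_rfl⟩
    · split_ifs with h1 h2 h2
      · simpa [h1] using htri k hk (π / 2)
          (LeeYang.isingZero_lt_half_pi hJ hconn he₀ le_rfl hk)
          (fun t ht => (LeeYang.isingZero_lt_half_pi hJ hconn he₀ ht hk).ne)
      · simpa [h1] using hnext k hk (by have := hk.2; omega)
      · simpa [h1] using htri k hk (π / 2)
          (LeeYang.isingZero_lt_half_pi hJ hconn he₀ le_rfl hk)
          (fun t ht => (LeeYang.isingZero_lt_half_pi hJ hconn he₀ ht hk).ne)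
      · simpa [h1] using hnext k hk (by have := hk.2; omega)
  · intro hodd
    have hmod := Nat.odd_iff.1 hodd
    refine ⟨fun t ht => ⟨?_, ?_, ?_⟩, fun k hk => ?_⟩
    · exact (LeeYang.isingZero_spec hJ hconn he₀ ht ⟨le_rfl, by omega⟩).1.1
    · exact LeeYang.strictMonoOn_isingZero hJ hconn he₀ ht
    · exact LeeYang.isingZero_eq_half_pi hJ hconn he₀ ht hodd
    · have hk2 := hk.2
      exact hnext k ⟨hk.1, by omega⟩ (by omega)
  · intro j hj k hk hjk
    rw [Set.disjoint_left]
    rintro _ ⟨s, hs, rfl⟩ ⟨t, ht, hst⟩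
    exact LeeYang.isingZero_ne_isingZero hJ hconn he₀ hj hk hjk hs ht hst.symm
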